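/- Let $d\ge 1$ and $s$ be natural numbers with $s>d/2$, and let $B\in\mathbb R^{d\times d}$ be a Frolov matrix, that is: (a) $B$ is invertible; (b) $\bigl|\prod_{j=1}^d (Bm)_j\bigr|\ge 1$ for all $m\in\mathbb Z^d\setminus\{0\}$; (c) for all $x,y\in\mathbb R^d$ the box $[x,y]=\{z\in\mathbb R^d : z_j \text{ is between } x_j \text{ and } y_j \text{ for all } j\}$ contains at most $\prod_{j=1}^d|x_j-y_j|+1$ of the lattice points $Bm$, $m\in\mathbb Z^d$. For an invertible matrix $S\in\mathbb R^{d\times d}$, $v\in\mathbb R^d$ and a compactly supported $f:\mathbb R^d\to\mathbb R$ put \[ Q_S^v(f)=\frac1{|\det S|}\sum_{m\in\mathbb Z^d} f\bigl(S^{-\top}(m+v)\bigr),\qquad I_d(f)=\int_{\mathbb R^d} f(x)\,dx , \] and write $\hat u=\mathrm{diag}(u_1,\dots,u_d)$ for $u\in\mathbb R^d$. Let $\mathring H^s([0,1]^d)$ be the set of all continuous functions $f:\mathbb R^d\to\mathbb R$ with support in $[0,1]^d$ such that $f$ and all its weak derivatives $D^\alpha f$ with $\alpha\in\mathbb N_0^d$,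 $|\alpha|=\alpha_1+\dots+\alpha_d\le s$, exist and belong to $L^2(\mathbb R^d)$, and let \[ \|f\|_{H^s([0,1]^d)}=\Bigl(\sum_{|\alpha|\le s}\|D^\alpha f\|_{L^2([0,1]^d)}^2\Bigr)^{1/2}. \] **Theorem.** There is a constant $c>0$, depending only on $d$, $s$ and $B$, such that for every integer $n\ge 1$, every $f\in\mathring H^s([0,1]^d)$ and all independent random vectors $U$, uniformly distributed in $[1,2^{1/d}]^d$, and $V$, uniformly distributed in $[0,1]^d$, the squared error $|Q^V_{n^{1/d}\hat U B}(f)-I_d(f)|^2$ is integrable and \[ \Bigl(\mathbb E\,\bigl|Q^V_{n^{1/d}\hat U B}(f)-I_d(f)\bigr|^2\Bigr)^{1/2}\le c\,n^{-s/d-1/2}\,\|f\|_{H^s([0,1]^d)} . \] -/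

import Mathlib

open MeasureTheory ProbabilityTheory

namespace FrolovRandom

noncomputable section

open scoped ContDiff

/-- The `i`-th partial derivative of a function on `ℝᵈ`. -/
def partialDeriv {d : ℕ} (i : Fin d) (φ : EuclideanSpace ℝ (Fin d) → ℝ) :
    EuclideanSpace ℝ (Fin d) → ℝ :=
  fun x => fderiv ℝ φ x (EuclideanSpace.single i 1)

/-- The iterated classical partial derivative `D^α φ = ∂₁^{α₁} ⋯ ∂_d^{α_d} φ`. -/
def multiDeriv {d : ℕ} (α : Fin d → ℕ) (φ : EuclideanSpace ℝ (Fin d) → ℝ) :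
    EuclideanSpace ℝ (Fin d) → ℝ :=
  (List.finRange d).foldr (fun i ψ => (partialDeriv i)^[α i] ψ) φ

/-- `g` is a weak derivative `D^α f` of `f` on the open set `O ⊆ ℝᵈ`. -/
structure IsWeakDeriv {d : ℕ} (O : Set (EuclideanSpace ℝ (Fin d))) (α : Fin d → ℕ)
    (f g : EuclideanSpace ℝ (Fin d) → ℝ) : Prop where
  locallyIntegrable_left : LocallyIntegrableOn f O volume
  locallyIntegrable_right : LocallyIntegrableOn g O volume
  integral_eq : ∀ φ : EuclideanSpace ℝ (Fin d) → ℝ, ContDiff ℝ ∞ φ → HasCompactSupport φ →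
    tsupport φ ⊆ O →
      ∫ x in O, f x * multiDeriv α φ x = (-1) ^ (∑ i, α i) * ∫ x in O, g x * φ x

/-- Weak derivatives on an open set are unique up to null sets, so that the choice made in
`weakDeriv` below does not matter. -/
theorem IsWeakDeriv.ae_eq {d : ℕ} {O : Set (EuclideanSpace ℝ (Fin d))} (hO : IsOpen O)
    {α : Fin d → ℕ} {f g h : EuclideanSpace ℝ (Fin d) → ℝ}
    (hg : IsWeakDeriv O α f g) (hh : IsWeakDeriv O α f h) :
    g =ᵐ[volume.restrict O] h := by
  have key : ∀ᵐ x ∂(volume : Measure (EuclideanSpace ℝ (Fin d))), x ∈ O → (g - h) x = 0 := by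
    refine hO.ae_eq_zero_of_integral_contDiff_smul_eq_zero
      (hg.locallyIntegrable_right.sub hh.locallyIntegrable_right) ?_
    intro φ hφ hφc hφO
    have e : ∫ x in O, g x * φ x = ∫ x in O, h x * φ x := by
      have e' := (hg.integral_eq φ hφ hφc hφO).symm.trans (hh.integral_eq φ hφ hφc hφO)
      exact mul_left_cancel₀ (pow_ne_zero _ (by norm_num)) e'
    have int : ∀ {u : EuclideanSpace ℝ (Fin d) → ℝ}, LocallyIntegrableOn u O volume →
        IntegrableOn (fun x => u x * φ x) O volume := by
      intro u hu
      have hK : IntegrableOn u (tsupport φ) volume :=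
        hu.integrableOn_compact_subset hφO hφc
      have h1 : IntegrableOn (fun x => u x * φ x) (tsupport φ) volume :=
        hK.mul_continuousOn hφ.continuous.continuousOn hφc
      refine (IntegrableOn.integrable_of_forall_notMem_eq_zero h1 ?_).integrableOn
      intro x hx
      simp [image_eq_zero_of_notMem_tsupport hx]
    have h0 : ∫ x in O, φ x • (g - h) x = 0 := by
      have : (fun x => φ x • (g - h) x) = fun x => g x * φ x - h x * φ x := by
        funext x
        simp only [Pi.sub_apply, smul_eq_mul]
        ring
      rw [this, integral_sub (int hg.locallyIntegrable_right) (int hh.locallyIntegrable_right), e,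
        sub_self]
    rw [← h0, setIntegral_eq_integral_of_forall_compl_eq_zero]
    intro x hx
    simp [image_eq_zero_of_notMem_tsupport (fun hx' => hx (hφO hx'))]
  have := (ae_restrict_iff' (μ := volume) hO.measurableSet (p := fun x => g x = h x)).2
    (key.mono fun x hx hxO => sub_eq_zero.1 (hx hxO))
  exact this

open Classical in
/-- The weak derivative `D^α f` of `f` on `O` (the zero function if there is none). -/
def weakDeriv {d : ℕ} (O : Set (EuclideanSpace ℝ (Fin d))) (α : Fin d → ℕ)
    (f : EuclideanSpace ℝ (Fin d) → ℝ) : EuclideanSpace ℝ (Fin d) → ℝ :=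
  if h : ∃ g, IsWeakDeriv O α f g then h.choose else 0

/-- The multi-indices `α ∈ ℕ₀ᵈ` with `|α| = α₁ + ⋯ + α_d ≤ s`. -/
def multiIndices (d s : ℕ) : Finset (Fin d → ℕ) :=
  (Fintype.piFinset fun _ : Fin d => Finset.range (s + 1)).filter fun α => ∑ i, α i ≤ s

theorem mem_multiIndices {d s : ℕ} {α : Fin d → ℕ} : α ∈ multiIndices d s ↔ ∑ i, α i ≤ s := by
  simp only [multiIndices, Finset.mem_filter, Fintype.mem_piFinset, Finset.mem_range,
    and_iff_right_iff_imp]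
  intro h i
  exact Nat.lt_succ_of_le ((Finset.single_le_sum (fun _ _ => Nat.zero_le _)
    (Finset.mem_univ i)).trans h)

/-- `f` belongs to the isotropic Sobolev space `H^s(O)`: `f ∈ L²(O)`, and for each `|α| ≤ s` the
weak derivative `D^α f` exists and is in `L²(O)`. -/
def MemSobolev {d : ℕ} (O : Set (EuclideanSpace ℝ (Fin d))) (s : ℕ)
    (f : EuclideanSpace ℝ (Fin d) → ℝ) : Prop :=
  MemLp f 2 (volume.restrict O) ∧
    ∀ α ∈ multiIndices d s, ∃ g, IsWeakDeriv O α f g ∧ MemLp g 2 (volume.restrict O)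

/-- The norm `(∑_{|α| ≤ s} ‖D^α f‖²_{L²(O)})^{1/2}` of the isotropic Sobolev space `H^s(O)`. -/
def sobolevNorm {d : ℕ} (O : Set (EuclideanSpace ℝ (Fin d))) (s : ℕ)
    (f : EuclideanSpace ℝ (Fin d) → ℝ) : ℝ :=
  Real.sqrt (∑ α ∈ multiIndices d s, ∫ x in O, (weakDeriv O α f x) ^ 2)

/-- The unit cube `[0,1]ᵈ`. -/
def unitCube (d : ℕ) : Set (EuclideanSpace ℝ (Fin d)) := {x | ∀ i, x i ∈ Set.Icc (0 : ℝ) 1}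

/-- The interior `(0,1)ᵈ` of the unit cube, the domain of the weak derivatives in the norm of
`H^s([0,1]ᵈ)` (the two cubes differ by a null set). -/
def openUnitCube (d : ℕ) : Set (EuclideanSpace ℝ (Fin d)) := {x | ∀ i, x i ∈ Set.Ioo (0 : ℝ) 1}

/-- The space `H̊^s([0,1]ᵈ)` of the functions in `H^s(ℝᵈ)` with support in the unit cube. Here
`s > d/2`, and the elements of `H^s(ℝᵈ)` are identified with their continuous representatives. -/
def sobolevZero (d s : ℕ) : Set (EuclideanSpace ℝ (Fin d) → ℝ) :=
  {f | Continuous f ∧ MemSobolev Set.univ s f ∧ tsupport f ⊆ unitCube d}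

/-- A Frolov matrix. The interval `Set.uIcc x y` in `ℝᵈ` is the box of all points each of whose
coordinates `z_j` is between `x_j` and `y_j`. -/
structure IsFrolovMatrix {d : ℕ} (B : Matrix (Fin d) (Fin d) ℝ) : Prop where
  isUnit : IsUnit B
  one_le_prod : ∀ m : Fin d → ℤ, m ≠ 0 → 1 ≤ |∏ j, (B.mulVec fun i => (m i : ℝ)) j|
  card_le : ∀ x y : Fin d → ℝ,
    {z ∈ Set.uIcc x y | ∃ m : Fin d → ℤ, z = B.mulVec fun i => (m i : ℝ)}.Finite ∧
    ({z ∈ Set.uIcc x y | ∃ m : Fin d → ℤ, z = B.mulVec fun i => (m i : ℝ)}.ncard : ℝ) ≤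
      (∏ j, |x j - y j|) + 1

/-- The quadrature rule `Q_S^v(f) = |det S|⁻¹ ∑_{m ∈ ℤᵈ} f(S^{-⊤}(m + v))`. For `f` with compact
support and invertible `S` only finitely many summands are nonzero. -/
def quadRule {d : ℕ} (S : Matrix (Fin d) (Fin d) ℝ) (v : Fin d → ℝ)
    (f : EuclideanSpace ℝ (Fin d) → ℝ) : ℝ :=
  1 / |S.det| *
    ∑' m : Fin d → ℤ, f (WithLp.toLp 2 ((S⁻¹).transpose.mulVec fun i => (m i : ℝ) + v i))

/-- The matrix `n^{1/d} û B` with the dilation matrix `û = diag(u₁, …, u_d)`. -/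
def dilatedMatrix {d : ℕ} (n : ℕ) (u : Fin d → ℝ) (B : Matrix (Fin d) (Fin d) ℝ) :
    Matrix (Fin d) (Fin d) ℝ :=
  (n : ℝ) ^ (1 / (d : ℝ)) • (Matrix.diagonal u * B)

end

end FrolovRandom

/-! For a fixed invertible `S`, the map `v ↦ Q_S^v(f)` is the `ℤᵈ`-periodization of `|det S|⁻¹
f(S^{-⊤} ·)`. Its mean over the unit box is `I(f)` and its `k`-th Fourier coefficient is `f̂(Sk)`,
so Parseval turns the mean square error over the shift into `∑_{k ≠ 0} |f̂(Sk)|²`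
(`lintegral_quadRule_sub_sq`).

Put `t = n^{1/d}`, `b = 2^{1/d}` and `S = t û B`. Integrating over `u ∈ [1,b]ᵈ` and substituting
`y_j = t (Bk)_j u_j` gives `∫ W(y) |f̂(y)|² dy`, where `W(y)` is the sum of `∏_j |t (Bk)_j|⁻¹` over
those `k ≠ 0` whose dilates reach `y` (`lintegral_tsum_dilation_le`). Let `p = ∏_j |y_j|/t`. For
such `k` both `1 ≤ ∏|(Bk)_j|` and `p ≤ bᵈ ∏|(Bk)_j| = 2 ∏|(Bk)_j|`, so each summand is at most
`3/(n(p+1))`; the box count in (c) allows at most `p + 1` of them. Hence `W ≤ 3/n`, which is the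
source of the extra `n^{-1/2}`. Moreover `W(y) = 0` unless some `|y_j| ≥ t`, so `W(y) ≤ (3/n) ∑_j
(|y_j|/t)^{2s}` (`weight_le`).

The transform of the weak derivative `∂_j^s f` has modulus `|2πy_j|^s |f̂(y)|`, so Plancherel bounds
`∫ |y_j|^{2s} |f̂|²` by the squared Sobolev norm (`lintegral_pow_mul_fourierInt_sq_le`). The factor
`t^{-2s} = n^{-2s/d}` supplies the rest of the rate. -/

namespace FrolovRandom

open scoped ENNReal

/-! ### Characters, Parseval on the unit box, and tiling by integer translates. -/

/-- The half-open unit box `(0,1]ᵈ`. -/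
def halfOpenBox (d : ℕ) : Set (Fin d → ℝ) := {x | ∀ i, x i ∈ Set.Ioc (0 : ℝ) 1}

theorem measurableSet_halfOpenBox (d : ℕ) : MeasurableSet (halfOpenBox d) :=
  MeasurableSet.univ_pi' fun _ => measurableSet_Ioc

theorem halfOpenBox_eq_pi (d : ℕ) :
    halfOpenBox d = Set.pi Set.univ fun _ => Set.Ioc (0 : ℝ) 1 := by
  ext x; simp [halfOpenBox]

theorem volume_halfOpenBox (d : ℕ) : volume (halfOpenBox d) = 1 := by
  rw [halfOpenBox_eq_pi, Real.volume_pi_Ioc]; simp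

/-- The integer vector `m` as a real vector. -/
def intVec {d : ℕ} (m : Fin d → ℤ) : Fin d → ℝ := fun i => (m i : ℝ)

theorem intVec_zero {d : ℕ} : intVec (0 : Fin d → ℤ) = 0 := by
  ext; simp [intVec]

/-- The character `x ↦ exp (-2πi y·x)`. -/
noncomputable def character {d : ℕ} (y x : Fin d → ℝ) : ℂ :=
  Complex.exp (-(2 * Real.pi * (y ⬝ᵥ x) : ℝ) * Complex.I)

theorem norm_character {d : ℕ} (y x : Fin d → ℝ) : ‖character y x‖ = 1 := by
  have := Complex.norm_exp_ofReal_mul_I (-(2 * Real.pi * (y ⬝ᵥ x)))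
  simpa [character] using this

theorem character_zero_left {d : ℕ} (x : Fin d → ℝ) : character 0 x = 1 := by
  simp [character]

theorem character_add_left {d : ℕ} (y z x : Fin d → ℝ) :
    character (y + z) x = character y x * character z x := by
  rw [character, character, character, ← Complex.exp_add, add_dotProduct]
  congr 1; push_cast; ring

theorem character_add_right {d : ℕ} (y z x : Fin d → ℝ) :
    character x (y + z) = character x y * character x z := by
  rw [character, character, character, ← Complex.exp_add, dotProduct_add]
  congr 1; push_cast; ring

theorem continuous_character {d : ℕ} :
    Continuous fun p : (Fin d → ℝ) × (Fin d → ℝ) => character p.1 p.2 := by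
  unfold character dotProduct
  fun_prop

theorem character_int_int {d : ℕ} (k m : Fin d → ℤ) :
    character (intVec k) (intVec m) = 1 := by
  rw [character, Complex.exp_eq_one_iff]
  refine ⟨-∑ i, k i * m i, ?_⟩
  simp only [dotProduct, intVec]
  push_cast
  ring

theorem mFourier_neg_coe {d : ℕ} (k : Fin d → ℤ) (x : Fin d → ℝ) :
    UnitAddTorus.mFourier (-k) (fun i => (x i : UnitAddCircle)) =
      character (intVec k) x := by
  simp only [UnitAddTorus.mFourier, ContinuousMap.coe_mk, fourier_coe_apply, character,
    ← Complex.exp_sum]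
  congr 1
  simp only [dotProduct, Pi.neg_apply, intVec]
  push_cast
  rw [Finset.mul_sum, ← Finset.sum_neg_distrib, Finset.sum_mul]
  refine Finset.sum_congr rfl fun i _ => ?_
  ring

theorem lintegral_enorm_sq_eq_ofReal {α : Type*} [MeasurableSpace α] {μ : Measure α} {F : α → ℂ}
    (hF : MemLp F 2 μ) : ∫⁻ x, ‖F x‖ₑ ^ 2 ∂μ = ENNReal.ofReal (∫ x, ‖F x‖ ^ 2 ∂μ) := by
  rw [ofReal_integral_eq_lintegral_ofReal (hF.integrable_norm_pow (by norm_num))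
    (Filter.Eventually.of_forall fun x => by positivity)]
  refine lintegral_congr fun x => ?_
  rw [ENNReal.ofReal_pow (norm_nonneg _), ofReal_norm]

/-- Parseval's identity for Fourier series on the unit box. -/
theorem lintegral_halfOpenBox_sq_eq_tsum {d : ℕ} {F : (Fin d → ℝ) → ℂ}
    (hF : MemLp F 2 (volume.restrict (halfOpenBox d))) :
    ∫⁻ v in halfOpenBox d, ‖F v‖ₑ ^ 2 =
      ∑' k : Fin d → ℤ, ‖∫ v in halfOpenBox d, character (intVec k) v * F v‖ₑ ^ 2 := by
  -- Each circle carries normalised Haar measure, so the torus has mass one, like the box.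
  let _ : MeasureSpace UnitAddCircle := ⟨AddCircle.haarAddCircle⟩
  have _ : IsProbabilityMeasure (volume : Measure UnitAddCircle) :=
    inferInstanceAs (IsProbabilityMeasure AddCircle.haarAddCircle)
  have hbox : {x : Fin d → ℝ | ∀ i, x i ∈ Set.Ioc ((0 : Fin d → ℝ) i) ((0 : Fin d → ℝ) i + 1)} =
      halfOpenBox d := by
    ext x; simp [halfOpenBox]
  let e := UnitAddTorus.measurableEquivPiIoc (0 : Fin d → ℝ)
  let G : UnitAddTorus (Fin d) → ℂ := fun x => F (e x).1
  have hGcoe : ∀ v ∈ halfOpenBox d, G (fun i => (v i : UnitAddCircle)) = F v := by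
    intro v hv
    rw [← hbox] at hv
    have := e.apply_symm_apply ⟨v, hv⟩
    rw [UnitAddTorus.coe_symm_measurableEquivPiIoc_apply] at this
    simp only [G, this]
  have hG : MemLp G 2 volume := by
    have h1 : MemLp (fun y : {x : Fin d → ℝ // ∀ i, x i ∈ Set.Ioc ((0 : Fin d → ℝ) i)
        ((0 : Fin d → ℝ) i + 1)} => F y.1) 2 (Measure.comap Subtype.val volume) := by
      have hs : MeasurableSet {x : Fin d → ℝ | ∀ i, x i ∈ Set.Ioc ((0 : Fin d → ℝ) i)
        ((0 : Fin d → ℝ) i + 1)} := hbox ▸ measurableSet_halfOpenBox d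
      have := (MeasurableEmbedding.subtype_coe hs).memLp_map_measure_iff (g := F) (p := 2)
        (μ := Measure.comap Subtype.val volume)
      refine this.1 ?_
      rw [map_comap_subtype_coe hs, hbox]
      exact hF
    exact h1.comp_measurePreserving (UnitAddTorus.measurePreserving_equivPiIoc 0)
  have hsum := UnitAddTorus.hasSum_sq_mFourierCoeff (hG.toLp G)
  have hcoef : ∀ k, UnitAddTorus.mFourierCoeff (hG.toLp G) k =
      ∫ v in halfOpenBox d, character (intVec k) v * F v := by
    intro k
    have h1 : UnitAddTorus.mFourierCoeff (hG.toLp G) k = UnitAddTorus.mFourierCoeff G k := by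
      refine integral_congr_ae ?_
      filter_upwards [hG.coeFn_toLp] with x hx
      rw [hx]
    rw [h1, UnitAddTorus.mFourierCoeff_eq_integral G k 0, hbox]
    refine setIntegral_congr_fun (measurableSet_halfOpenBox d) fun v hv => ?_
    simp only [mFourier_neg_coe, hGcoe v hv, smul_eq_mul]
  have hint : ∫⁻ v in halfOpenBox d, ‖F v‖ₑ ^ 2 =
      ENNReal.ofReal (∫ t, ‖(hG.toLp G : UnitAddTorus (Fin d) → ℂ) t‖ ^ 2) := by
    rw [← lintegral_enorm_sq_eq_ofReal (Lp.memLp _)]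
    have h1 : ∫⁻ t, ‖(hG.toLp G : UnitAddTorus (Fin d) → ℂ) t‖ₑ ^ 2 = ∫⁻ t, ‖G t‖ₑ ^ 2 := by
      refine lintegral_congr_ae ?_
      filter_upwards [hG.coeFn_toLp] with x hx
      rw [hx]
    rw [h1, UnitAddTorus.lintegral_preimage _ 0, hbox]
    refine setLIntegral_congr_fun (measurableSet_halfOpenBox d) fun v hv => ?_
    simp only [hGcoe v hv]
  rw [hint, ← hsum.tsum_eq, ENNReal.ofReal_tsum_of_nonneg (fun _ => by positivity) hsum.summable]
  refine tsum_congr fun k => ?_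
  rw [hcoef, ENNReal.ofReal_pow (norm_nonneg _), ofReal_norm]

/-- The integer translates of the half-open unit box tile `ℝᵈ`. -/
theorem volume_eq_sum_translates (d : ℕ) :
    (volume : Measure (Fin d → ℝ)) = Measure.sum fun m : Fin d → ℤ =>
      (volume.restrict (halfOpenBox d)).map fun v => v + intVec m := by
  let S : (Fin d → ℤ) → Set (Fin d → ℝ) := fun m => {x | x - intVec m ∈ halfOpenBox d}
  have hSm : ∀ m, MeasurableSet (S m) := fun m =>
    (measurable_id.sub_const (intVec m)) (measurableSet_halfOpenBox d)
  have hmap : ∀ m, (volume.restrict (halfOpenBox d)).map (fun v => v + intVec m) =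
      volume.restrict (S m) := by
    intro m
    have h := ((measurePreserving_add_right (volume : Measure (Fin d → ℝ))
      (intVec m)).restrict_preimage (hSm m)).map_eq
    have hpre : (fun v => v + intVec m) ⁻¹' S m = halfOpenBox d := by
      ext v; simp [S]
    rwa [hpre] at h
  simp only [hmap]
  rw [← Measure.restrict_iUnion ?_ hSm]
  · have : ⋃ m, S m = Set.univ := by
      -- The cells are open on the left and closed on the right, hence `⌈x⌉ - 1` rather than the
      -- floor.
      refine Set.eq_univ_of_forall fun x => Set.mem_iUnion.2 ⟨fun i => ⌈x i⌉ - 1, fun i => ?_⟩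
      have h1 := Int.le_ceil (x i)
      have h2 := Int.ceil_lt_add_one (x i)
      simp only [intVec, Pi.sub_apply, Int.cast_sub, Int.cast_one, Set.mem_Ioc]
      constructor <;> linarith
    rw [this, Measure.restrict_univ]
  · intro m m' hne
    refine Set.disjoint_left.2 fun x hx hx' => hne ?_
    ext i
    have h1 := hx i
    have h2 := hx' i
    simp only [intVec, Pi.sub_apply, Set.mem_Ioc] at h1 h2
    have a : (m i : ℝ) < m' i + 1 := by linarith
    have b : (m' i : ℝ) < m i + 1 := by linarith
    norm_cast at a b
    omega

theorem lintegral_eq_tsum_translates {d : ℕ} {h : (Fin d → ℝ) → ℝ≥0∞} (hh : Measurable h) :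
    ∫⁻ x, h x = ∑' m : Fin d → ℤ, ∫⁻ v in halfOpenBox d, h (v + intVec m) := by
  conv_lhs => rw [volume_eq_sum_translates d]
  rw [lintegral_sum_measure]
  refine tsum_congr fun m => ?_
  rw [lintegral_map hh (by fun_prop)]

theorem integral_eq_tsum_translates {d : ℕ} {h : (Fin d → ℝ) → ℂ} (hh : Measurable h)
    (hi : Integrable h) :
    ∫ x, h x = ∑' m : Fin d → ℤ, ∫ v in halfOpenBox d, h (v + intVec m) := by
  have hi' := hi
  rw [volume_eq_sum_translates d] at hi'
  conv_lhs => rw [volume_eq_sum_translates d]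
  rw [integral_sum_measure hi']
  refine tsum_congr fun m => ?_
  rw [integral_map (by fun_prop) hh.aestronglyMeasurable]

/-! ### The Fourier transform and Plancherel for functions on the box. -/

/-- The Fourier transform `y ↦ ∫ g(x) exp(-2πi y·x) dx`. -/
noncomputable def fourierInt {d : ℕ} (g : (Fin d → ℝ) → ℂ) (y : Fin d → ℝ) : ℂ :=
  ∫ x, character y x * g x

theorem fourierInt_zero {d : ℕ} (g : (Fin d → ℝ) → ℂ) : fourierInt g 0 = ∫ x, g x := by
  simp [fourierInt, character_zero_left]

theorem measurable_fourierInt {d : ℕ} {g : (Fin d → ℝ) → ℂ} (hg : AEStronglyMeasurable g volume) :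
    Measurable (fourierInt g) := by
  -- The parametric integral needs joint measurability in `(y, x)`, so `g` is replaced by a strongly
  -- measurable representative.
  have h1 : fourierInt g = fun y => ∫ x, character y x * hg.mk g x := by
    ext y
    refine integral_congr_ae ?_
    filter_upwards [hg.ae_eq_mk] with x hx
    rw [hx]
  rw [h1]
  refine StronglyMeasurable.measurable ?_
  refine StronglyMeasurable.integral_prod_right' (f := fun p : (Fin d → ℝ) × (Fin d → ℝ) =>
    character p.1 p.2 * hg.mk g p.2) ?_
  exact continuous_character.stronglyMeasurable.mul
    (hg.stronglyMeasurable_mk.comp_measurable measurable_snd)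

theorem continuous_character_right {d : ℕ} (y : Fin d → ℝ) : Continuous (character y) :=
  continuous_character.comp (by fun_prop : Continuous fun x : Fin d → ℝ => (y, x))

theorem enorm_character {d : ℕ} (y x : Fin d → ℝ) : ‖character y x‖ₑ = 1 := by
  rw [← ofReal_norm, norm_character, ENNReal.ofReal_one]

/-- Plancherel's identity for square-integrable functions on the unit box. -/
theorem lintegral_fourierInt_sq {d : ℕ} {g : (Fin d → ℝ) → ℂ} (hg : MemLp g 2 volume)
    (h0 : ∀ᵐ x, x ∉ halfOpenBox d → g x = 0) :
    ∫⁻ y, ‖fourierInt g y‖ₑ ^ 2 = ∫⁻ x, ‖g x‖ₑ ^ 2 := by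
  have hmeas := measurable_fourierInt hg.1
  have hbox : ∀ y, fourierInt g y = ∫ v in halfOpenBox d, character y v * g v := by
    intro y
    rw [fourierInt, setIntegral_eq_integral_of_ae_compl_eq_zero]
    filter_upwards [h0] with x hx hx'
    rw [hx hx', mul_zero]
  have hbox' : ∫⁻ x, ‖g x‖ₑ ^ 2 = ∫⁻ x in halfOpenBox d, ‖g x‖ₑ ^ 2 := by
    rw [← lintegral_indicator (measurableSet_halfOpenBox d)]
    refine lintegral_congr_ae ?_
    filter_upwards [h0] with x hx
    by_cases hxb : x ∈ halfOpenBox d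
    · simp [hxb]
    · simp [hxb, hx hxb]
  rw [lintegral_eq_tsum_translates (by fun_prop), ← lintegral_tsum (fun m => by fun_prop)]
  -- The values of the transform on `θ + ℤᵈ` are the Fourier coefficients of `character θ * g`,
  -- which has the same modulus as `g`. Parseval therefore gives the same sum for every `θ`, and
  -- integrating over a box of volume one yields Plancherel.
  have key : ∀ θ : Fin d → ℝ, ∑' m : Fin d → ℤ, ‖fourierInt g (θ + intVec m)‖ₑ ^ 2 =
      ∫⁻ x, ‖g x‖ₑ ^ 2 := by
    intro θ
    have hF : MemLp (fun v => character θ v * g v) 2 (volume.restrict (halfOpenBox d)) := by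
      refine (hg.restrict _).of_le (f := fun v => character θ v * g v)
        ((continuous_character_right θ).aestronglyMeasurable.mul hg.1.restrict) ?_
      filter_upwards with v
      simp [norm_character]
    have := lintegral_halfOpenBox_sq_eq_tsum hF
    rw [hbox']
    refine Eq.trans ?_ (this.symm.trans ?_)
    · refine tsum_congr fun m => ?_
      rw [hbox]
      congr 2
      refine integral_congr_ae (Filter.Eventually.of_forall fun v => ?_)
      change character (θ + intVec m) v * g v = character (intVec m) v * (character θ v * g v)
      rw [character_add_left]; ring
    · refine lintegral_congr fun v => ?_
      rw [enorm_mul, enorm_character, one_mul]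
  simp only [key, lintegral_const, Measure.restrict_apply_univ, volume_halfOpenBox, mul_one]

/-- Parseval for the constant `1`: the coefficient at `0` already exhausts the norm, so all others
vanish. -/
theorem integral_halfOpenBox_character {d : ℕ} {k : Fin d → ℤ} (hk : k ≠ 0) :
    ∫ v in halfOpenBox d, character (intVec k) v = 0 := by
  have : IsFiniteMeasure ((volume : Measure (Fin d → ℝ)).restrict (halfOpenBox d)) :=
    ⟨by simp [volume_halfOpenBox]⟩
  have h := lintegral_halfOpenBox_sq_eq_tsum (d := d) (F := fun _ => 1) (memLp_const _)
  simp only [enorm_one, one_pow, lintegral_const, Measure.restrict_apply_univ,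
    volume_halfOpenBox, mul_one] at h
  have h2 := ENNReal.sum_le_tsum (f := fun k : Fin d → ℤ =>
    ‖∫ v in halfOpenBox d, character (intVec k) v‖ₑ ^ 2) {0, k}
  rw [← h, Finset.sum_pair hk.symm] at h2
  have h3 : ∫ v in halfOpenBox d, character (intVec (0 : Fin d → ℤ)) v = 1 := by
    simp [intVec_zero, character_zero_left, volume_halfOpenBox, Measure.real]
  rw [h3, enorm_one, one_pow] at h2
  have h4 : ‖∫ v in halfOpenBox d, character (intVec k) v‖ₑ ^ 2 = 0 := by
    have h5 : 1 + ‖∫ v in halfOpenBox d, character (intVec k) v‖ₑ ^ 2 ≤ 1 + 0 := by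
      simpa using h2
    exact le_antisymm ((ENNReal.add_le_add_iff_left ENNReal.one_ne_top).1 h5) bot_le
  simpa using h4

/-! ### The mean square error over random shifts. -/

/-- Only finitely many integer translates of a bounded set meet the unit cube. -/
theorem exists_finset_translates {d : ℕ} {E : Type*} [Zero E] {g : (Fin d → ℝ) → E} {R : ℝ}
    (hR : ∀ x, R < ‖x‖ → g x = 0) :
    ∃ K : Finset (Fin d → ℤ), ∀ v : Fin d → ℝ, (∀ i, v i ∈ Set.Icc (0 : ℝ) 1) → ∀ m ∉ K,
      g (v + intVec m) = 0 := by
  refine ⟨Fintype.piFinset fun _ => Finset.Icc (-⌈R + 1⌉) ⌈R + 1⌉, fun v hv m hm => hR _ ?_⟩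
  by_contra hle
  refine hm (Fintype.mem_piFinset.2 fun i => Finset.mem_Icc.2 ?_)
  have h1 := (norm_le_pi_norm (v + intVec m) i).trans (not_lt.1 hle)
  rw [Real.norm_eq_abs, abs_le] at h1
  simp only [Pi.add_apply, intVec] at h1
  have h2 := hv i
  have h3 := Int.le_ceil (R + 1)
  have a : -(⌈R + 1⌉ : ℝ) ≤ m i := by linarith [h1.1, h2.2]
  have b : (m i : ℝ) ≤ ⌈R + 1⌉ := by linarith [h1.2, h2.1]
  exact ⟨by exact_mod_cast a, by exact_mod_cast b⟩

/-- The mean square over the unit box of the error of the shifted lattice rule. -/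
theorem lintegral_periodization_sub_sq {d : ℕ} {g : (Fin d → ℝ) → ℂ} (hg : Continuous g)
    (hc : HasCompactSupport g) :
    ∫⁻ v in halfOpenBox d, ‖(∑' m : Fin d → ℤ, g (v + intVec m)) - ∫ x, g x‖ₑ ^ 2 =
      ∑' k : Fin d → ℤ, if k = 0 then 0 else ‖fourierInt g (intVec k)‖ₑ ^ 2 := by
  have : IsFiniteMeasure ((volume : Measure (Fin d → ℝ)).restrict (halfOpenBox d)) :=
    ⟨by simp [volume_halfOpenBox]⟩
  obtain ⟨R, hR⟩ := hc.isCompact.isBounded.exists_norm_le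
  obtain ⟨K, hK⟩ := exists_finset_translates (g := g) (R := R) fun x hx =>
    image_eq_zero_of_notMem_tsupport fun h => absurd (hR x h) (not_le.2 hx)
  obtain ⟨M, hM⟩ := hg.bounded_above_of_compact_support hc
  have hbd : ∀ v ∈ halfOpenBox d, ∀ i, v i ∈ Set.Icc (0 : ℝ) 1 := fun v hv i =>
    Set.Ioc_subset_Icc_self (hv i)
  have htsum : ∀ v ∈ halfOpenBox d, ∑' m : Fin d → ℤ, g (v + intVec m) =
      ∑ m ∈ K, g (v + intVec m) := fun v hv => tsum_eq_sum fun m hm => hK v (hbd v hv) m hm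
  have hcont : ∀ m, Continuous fun v => g (v + intVec m) := fun m => hg.comp (by fun_prop)
  have hmem : ∀ m, MemLp (fun v => g (v + intVec m)) 2 (volume.restrict (halfOpenBox d)) :=
    fun m => MemLp.of_bound (hcont m).aestronglyMeasurable M (Filter.Eventually.of_forall
      fun v => hM _)
  have hF : MemLp (fun v => (∑ m ∈ K, g (v + intVec m)) - ∫ x, g x) 2
      (volume.restrict (halfOpenBox d)) :=
    (memLp_finsetSum K fun m _ => hmem m).sub (memLp_const _)
  have h1 : ∫⁻ v in halfOpenBox d, ‖(∑' m : Fin d → ℤ, g (v + intVec m)) - ∫ x, g x‖ₑ ^ 2 =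
      ∫⁻ v in halfOpenBox d, ‖(∑ m ∈ K, g (v + intVec m)) - ∫ x, g x‖ₑ ^ 2 :=
    setLIntegral_congr_fun (measurableSet_halfOpenBox d) fun v hv => by
      simp only [htsum v hv]
  rw [h1, lintegral_halfOpenBox_sq_eq_tsum hF]
  have hint : ∀ k m : Fin d → ℤ, Integrable (fun v => character (intVec k) v * g (v + intVec m))
      (volume.restrict (halfOpenBox d)) := fun k m =>
    ((hmem m).integrable (by norm_num)).bdd_mul (c := 1)
      (continuous_character_right _).aestronglyMeasurable
      (Filter.Eventually.of_forall fun v => (norm_character _ v).le)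
  -- Unfolding: integer characters are invariant under integer shifts and the translated boxes tile
  -- space, so the periodization has coefficient `fourierInt g` at `k`. The subtracted constant only
  -- affects `k = 0`, where it cancels that coefficient.
  have hcoef : ∀ k : Fin d → ℤ, ∫ v in halfOpenBox d,
      character (intVec k) v * ((∑ m ∈ K, g (v + intVec m)) - ∫ x, g x) =
        fourierInt g (intVec k) - (∫ v in halfOpenBox d, character (intVec k) v) * ∫ x, g x := by
    intro k
    have hchar : Integrable (character (intVec k)) (volume.restrict (halfOpenBox d)) :=
      (memLp_top_of_bound (continuous_character_right _).aestronglyMeasurable 1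
        (Filter.Eventually.of_forall fun v => (norm_character _ v).le)).integrable le_top
    simp only [mul_sub, Finset.mul_sum]
    rw [integral_sub (integrable_finsetSum _ fun m _ => hint k m) (hchar.mul_const _),
      integral_finsetSum _ fun m _ => hint k m, integral_mul_const]
    congr 1
    have hcg : Continuous fun x => character (intVec k) x * g x :=
      (continuous_character_right _).mul hg
    rw [fourierInt, integral_eq_tsum_translates hcg.measurable
      (hcg.integrable_of_hasCompactSupport hc.mul_left), tsum_eq_sum (s := K)]
    · refine Finset.sum_congr rfl fun m _ => integral_congr_ae
        (Filter.Eventually.of_forall fun v => ?_)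
      simp only [character_add_right, character_int_int, mul_one]
    · intro m hm
      refine setIntegral_eq_zero_of_forall_eq_zero fun v hv => ?_
      rw [hK v (hbd v hv) m hm, mul_zero]
  refine tsum_congr fun k => ?_
  rw [hcoef]
  split_ifs with hk
  · subst hk
    simp [intVec_zero, character_zero_left, fourierInt_zero, volume_halfOpenBox, Measure.real]
  · rw [integral_halfOpenBox_character hk, zero_mul, sub_zero]

/-- A function on Euclidean space as a complex-valued function of the coordinates. -/
noncomputable def toPi {d : ℕ} (f : EuclideanSpace ℝ (Fin d) → ℝ) (x : Fin d → ℝ) : ℂ :=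
  (f (WithLp.toLp 2 x) : ℂ)

theorem continuous_toPi {d : ℕ} {f : EuclideanSpace ℝ (Fin d) → ℝ} (hf : Continuous f) :
    Continuous (toPi f) :=
  Complex.continuous_ofReal.comp (hf.comp (PiLp.continuous_toLp 2 _))

theorem hasCompactSupport_toPi {d : ℕ} {f : EuclideanSpace ℝ (Fin d) → ℝ}
    (hf : HasCompactSupport f) : HasCompactSupport (toPi f) := by
  refine HasCompactSupport.intro (hf.isCompact.image (PiLp.continuous_ofLp 2 _)) fun x hx => ?_
  have : WithLp.toLp 2 x ∉ tsupport f := fun h => hx ⟨_, h, rfl⟩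
  simp [toPi, image_eq_zero_of_notMem_tsupport this]

theorem integral_comp_toLp {d : ℕ} {E : Type*} [NormedAddCommGroup E] [NormedSpace ℝ E]
    (f : EuclideanSpace ℝ (Fin d) → E) :
    ∫ x : Fin d → ℝ, f (WithLp.toLp 2 x) = ∫ x, f x :=
  (PiLp.volume_preserving_toLp (Fin d)).integral_comp
    (MeasurableEquiv.toLp 2 (Fin d → ℝ)).measurableEmbedding f

theorem integral_toPi {d : ℕ} (f : EuclideanSpace ℝ (Fin d) → ℝ) :
    ∫ x, toPi f x = ((∫ x, f x : ℝ) : ℂ) := by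
  rw [← integral_comp_toLp]
  exact integral_complex_ofReal

theorem integral_comp_mulVec {d : ℕ} {A : Matrix (Fin d) (Fin d) ℝ} (hA : A.det ≠ 0)
    {h : (Fin d → ℝ) → ℂ} (hh : Measurable h) :
    ∫ v, h (A.mulVec v) = (|A.det|⁻¹ : ℝ) * ∫ x, h x := by
  have hm : Measurable (Matrix.toLin' A) :=
    (LinearMap.continuous_of_finiteDimensional _).measurable
  have h1 := integral_map (μ := volume) hm.aemeasurable (f := h) hh.aestronglyMeasurable
  rw [Real.map_matrix_volume_pi_eq_smul_volume_pi hA, integral_smul_measure,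
    ENNReal.toReal_ofReal (abs_nonneg _), abs_inv] at h1
  simpa [Matrix.toLin'_apply] using h1.symm

/-- The mean square error over random shifts of a lattice rule is the sum of the squared Fourier
transform over the nonzero points of the dual lattice. -/
theorem lintegral_quadRule_sub_sq {d : ℕ} {S : Matrix (Fin d) (Fin d) ℝ} (hS : S.det ≠ 0)
    {f : EuclideanSpace ℝ (Fin d) → ℝ} (hf : Continuous f) (hc : HasCompactSupport f) :
    ∫⁻ v in halfOpenBox d, ‖quadRule S v f - ∫ x, f x‖ₑ ^ 2 =
      ∑' k : Fin d → ℤ, if k = 0 then 0 else ‖fourierInt (toPi f) (S.mulVec (intVec k))‖ₑ ^ 2 := by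
  set A : Matrix (Fin d) (Fin d) ℝ := (S⁻¹).transpose with hA
  have hSu : IsUnit S.det := isUnit_iff_ne_zero.2 hS
  have hAdet : A.det = S.det⁻¹ := by
    rw [hA, Matrix.det_transpose, Matrix.det_nonsing_inv, Ring.inverse_eq_inv']
  have hAS : S.transpose * A = 1 := by
    rw [hA, ← Matrix.transpose_mul, Matrix.nonsing_inv_mul S hSu, Matrix.transpose_one]
  have hdot : ∀ k v, S.mulVec k ⬝ᵥ A.mulVec v = k ⬝ᵥ v := by
    intro k v
    rw [← Matrix.vecMul_transpose, ← Matrix.dotProduct_mulVec, Matrix.mulVec_mulVec, hAS,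
      Matrix.one_mulVec]
  have hAcont : Continuous fun v => A.mulVec v :=
    continuous_const.matrix_mulVec continuous_id
  -- The quadrature rule is the periodization of this function. Since `Sk · S^{-⊤}v = k · v` and the
  -- Jacobian cancels `1/|det S|`, its transform at `k` is that of `f` at `Sk`.
  set h : (Fin d → ℝ) → ℂ := fun v => (1 / |S.det| : ℝ) * toPi f (A.mulVec v) with hh
  have hcont : Continuous h := continuous_const.mul ((continuous_toPi hf).comp hAcont)
  have hcs : HasCompactSupport h := by
    have hST : Continuous fun v => S.transpose.mulVec v :=
      continuous_const.matrix_mulVec continuous_id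
    refine HasCompactSupport.intro ((hasCompactSupport_toPi hc).isCompact.image hST) fun v hv => ?_
    have : A.mulVec v ∉ tsupport (toPi f) := fun hmem =>
      hv ⟨_, hmem, by simp only [Matrix.mulVec_mulVec, hAS, Matrix.one_mulVec]⟩
    simp [hh, image_eq_zero_of_notMem_tsupport this]
  have hfour : ∀ k, fourierInt h k = fourierInt (toPi f) (S.mulVec k) := by
    intro k
    have h1 := integral_comp_mulVec (A := A) (by rw [hAdet]; exact inv_ne_zero hS)
      (h := fun x => character (S.mulVec k) x * toPi f x)
      ((continuous_character_right _).mul (continuous_toPi hf)).measurable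
    have h2 : ∀ v, character k v * h v =
        (1 / |S.det| : ℝ) * (character (S.mulVec k) (A.mulVec v) * toPi f (A.mulVec v)) := by
      intro v
      have : character (S.mulVec k) (A.mulVec v) = character k v := by
        simp only [character, hdot]
      rw [this, hh]; ring
    rw [fourierInt, integral_congr_ae (Filter.Eventually.of_forall h2), integral_const_mul, h1,
      hAdet, ← mul_assoc, ← Complex.ofReal_mul, abs_inv, inv_inv, one_div,
      inv_mul_cancel₀ (abs_ne_zero.2 hS), Complex.ofReal_one, one_mul, fourierInt]
  have hI : ∫ x, h x = ((∫ x, f x : ℝ) : ℂ) := by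
    rw [← fourierInt_zero, hfour, Matrix.mulVec_zero, fourierInt_zero, integral_toPi]
  have hQ : ∀ v, ((quadRule S v f : ℝ) : ℂ) = ∑' m : Fin d → ℤ, h (v + intVec m) := by
    intro v
    rw [quadRule, Complex.ofReal_mul, Complex.ofReal_tsum, ← tsum_mul_left]
    refine tsum_congr fun m => ?_
    have : (fun i => (m i : ℝ) + v i) = v + intVec m := by
      ext i; simp [intVec, add_comm]
    rw [this]
    rfl
  have := lintegral_periodization_sub_sq hcont hcs
  simp only [hfour] at this
  rw [← this, hI]
  refine lintegral_congr fun v => ?_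
  rw [← hQ, ← Complex.ofReal_sub, ← ofReal_norm, ← ofReal_norm, Complex.norm_real]

/-! ### Averaging over random dilations of a Frolov lattice. -/

/-- Change of variables for a coordinatewise dilation. -/
theorem setLIntegral_comp_dilation {d : ℕ} {D : Fin d → ℝ} (hD : ∀ j, D j ≠ 0)
    {C : Set (Fin d → ℝ)} (hC : MeasurableSet C) {h : (Fin d → ℝ) → ℝ≥0∞} (hh : Measurable h) :
    ∫⁻ u in C, h (fun j => D j * u j) =
      ENNReal.ofReal |∏ j, D j|⁻¹ * ∫⁻ y, {y | (fun j => y j / D j) ∈ C}.indicator h y := by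
  have hdet : (Matrix.diagonal D).det ≠ 0 := by
    rw [Matrix.det_diagonal]; exact Finset.prod_ne_zero_iff.2 fun j _ => hD j
  have hm : Measurable (Matrix.toLin' (Matrix.diagonal D)) :=
    (LinearMap.continuous_of_finiteDimensional _).measurable
  have hE : MeasurableSet {y : Fin d → ℝ | (fun j => y j / D j) ∈ C} := by
    have : Measurable fun y : Fin d → ℝ => fun j => y j / D j := by fun_prop
    exact this hC
  have h1 := lintegral_map (μ := volume) (hh.indicator hE) hm
  rw [Real.map_matrix_volume_pi_eq_smul_volume_pi hdet, lintegral_smul_measure,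
    Matrix.det_diagonal, abs_inv, smul_eq_mul] at h1
  rw [h1, ← lintegral_indicator hC]
  refine lintegral_congr fun u => ?_
  have h2 : Matrix.toLin' (Matrix.diagonal D) u = fun j => D j * u j := by
    ext j; simp [Matrix.toLin'_apply, Matrix.mulVec_diagonal]
  have h3 : (fun j => D j * u j / D j) = u := by
    ext j; field_simp [hD j]
  rw [h2]
  by_cases hu : u ∈ C
  · rw [Set.indicator_of_mem hu, Set.indicator_of_mem]
    simpa only [Set.mem_ofPred_eq, h3] using hu
  · rw [Set.indicator_of_notMem hu, Set.indicator_of_notMem]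
    simpa only [Set.mem_ofPred_eq, h3] using hu

theorem mulVec_intVec_ne_zero {d : ℕ} {B : Matrix (Fin d) (Fin d) ℝ} (hB : IsFrolovMatrix B)
    {k : Fin d → ℤ} (hk : k ≠ 0) (j : Fin d) : B.mulVec (intVec k) j ≠ 0 := by
  intro h
  have h1 := hB.one_le_prod k hk
  have h2 : ∏ j, B.mulVec (intVec k) j = 0 := Finset.prod_eq_zero (Finset.mem_univ j) h
  have h3 : |∏ j, B.mulVec (intVec k) j| = 0 := by rw [h2, abs_zero]
  have h4 : (1 : ℝ) ≤ |∏ j, B.mulVec (intVec k) j| := h1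
  linarith

theorem injective_mulVec_intVec {d : ℕ} {B : Matrix (Fin d) (Fin d) ℝ} (hB : IsFrolovMatrix B) :
    Function.Injective fun k : Fin d → ℤ => B.mulVec (intVec k) := by
  intro k l h
  have h1 := Matrix.mulVec_injective_iff_isUnit.2 hB.isUnit h
  ext i
  have h2 := congrFun h1 i
  simpa [intVec] using h2

/-- The lattice points `m ≠ 0` of a Frolov lattice whose random dilates can hit `y`. -/
def dilationPreimages {d : ℕ} (B : Matrix (Fin d) (Fin d) ℝ) (t b : ℝ) (y : Fin d → ℝ) :
    Set (Fin d → ℤ) :=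
  {k | k ≠ 0 ∧ ∀ j, y j / (t * B.mulVec (intVec k) j) ∈ Set.Icc 1 b}

theorem bounds_of_mem_dilationPreimages {d : ℕ} {B : Matrix (Fin d) (Fin d) ℝ}
    (hB : IsFrolovMatrix B) {t b : ℝ} (ht : 0 < t) {y : Fin d → ℝ} {k : Fin d → ℤ}
    (hk : k ∈ dilationPreimages B t b y) (j : Fin d) :
    |B.mulVec (intVec k) j| ≤ |y j| / t ∧ |y j| / t ≤ b * |B.mulVec (intVec k) j| := by
  have hz : 0 < |B.mulVec (intVec k) j| := abs_pos.2 (mulVec_intVec_ne_zero hB hk.1 j)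
  obtain ⟨h1, h2⟩ := hk.2 j
  have h3 : y j / (t * B.mulVec (intVec k) j) = |y j| / (t * |B.mulVec (intVec k) j|) := by
    rw [← abs_of_nonneg (zero_le_one.trans h1), abs_div, abs_mul, abs_of_pos ht]
  rw [h3, le_div_iff₀ (by positivity)] at h1
  rw [h3, div_le_iff₀ (by positivity)] at h2
  constructor
  · rw [le_div_iff₀ ht]; linarith
  · rw [div_le_iff₀ ht]; linarith

/-- Each `y_j` is `t u_j (Bk)_j` with `1 ≤ u_j ≤ b`, so dividing by `t` and by `t b` brackets
`(Bk)_j` from either side, whatever its sign. This puts the lattice points in a box to which the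
counting property applies. -/
theorem mem_uIcc_of_mem_dilationPreimages {d : ℕ} {B : Matrix (Fin d) (Fin d) ℝ}
    (hB : IsFrolovMatrix B) {t b : ℝ} (ht : 0 < t) (hb : 0 < b) {y : Fin d → ℝ} {k : Fin d → ℤ}
    (hk : k ∈ dilationPreimages B t b y) :
    B.mulVec (intVec k) ∈ Set.uIcc (fun j => y j / (t * b)) fun j => y j / t := by
  have key : ∀ j, B.mulVec (intVec k) j ∈ Set.uIcc (y j / (t * b)) (y j / t) := by
    intro j
    have hz := mulVec_intVec_ne_zero hB hk.1 j
    obtain ⟨h1, h2⟩ := hk.2 j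
    set z := B.mulVec (intVec k) j
    set u := y j / (t * z) with hu
    have hy : y j = t * u * z := by rw [hu]; field_simp
    have e1 : y j / (t * b) = u / b * z := by rw [hy]; field_simp
    have e2 : y j / t = u * z := by rw [hy]; field_simp
    have hub : u / b ≤ 1 := (div_le_one hb).2 h2
    rw [e1, e2, Set.mem_uIcc]
    rcases le_total 0 z with hz0 | hz0
    · left; constructor <;> nlinarith
    · right; constructor <;> nlinarith
  rw [Set.uIcc, Set.mem_Icc]
  exact ⟨fun j => (key j).1, fun j => (key j).2⟩

/-- The bracketing box has sides `(1 - 1/b)|y_j|/t`; bounding them by `|y_j|/t` is enough, as the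
count then matches the `p + 1` in the summand bound of `weight_le`. -/
theorem finite_dilationPreimages {d : ℕ} {B : Matrix (Fin d) (Fin d) ℝ}
    (hB : IsFrolovMatrix B) {t b : ℝ} (ht : 0 < t) (hb : 1 ≤ b) (y : Fin d → ℝ) :
    (dilationPreimages B t b y).Finite ∧
      ((dilationPreimages B t b y).ncard : ℝ) ≤ ∏ j, |y j| / t + 1 := by
  have hb0 : 0 < b := zero_lt_one.trans_le hb
  obtain ⟨hfin, hcard⟩ := hB.card_le (fun j => y j / (t * b)) fun j => y j / t
  have hmaps : Set.MapsTo (fun k : Fin d → ℤ => B.mulVec (intVec k)) (dilationPreimages B t b y)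
      {z ∈ Set.uIcc (fun j => y j / (t * b)) fun j => y j / t |
        ∃ m : Fin d → ℤ, z = B.mulVec fun i => (m i : ℝ)} :=
    fun k hk => ⟨mem_uIcc_of_mem_dilationPreimages hB ht hb0 hk, k, rfl⟩
  have hinj := (injective_mulVec_intVec hB).injOn (s := dilationPreimages B t b y)
  refine ⟨Set.Finite.of_injOn hmaps hinj hfin, ?_⟩
  have h1 : ((dilationPreimages B t b y).ncard : ℝ) ≤ _ :=
    Nat.cast_le.2 (Set.ncard_le_ncard_of_injOn _ hmaps hinj hfin)
  refine h1.trans (hcard.trans ?_)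
  gcongr with j
  have h2 : y j / (t * b) - y j / t = -(y j / t * (1 - b⁻¹)) := by field_simp; ring
  have h3 : b⁻¹ ≤ 1 := inv_le_one_of_one_le₀ hb
  have h4 : 0 < b⁻¹ := inv_pos.2 hb0
  rw [h2, abs_neg, abs_mul, abs_div, abs_of_pos ht, abs_of_nonneg (sub_nonneg.2 h3)]
  exact mul_le_of_le_one_right (by positivity) (by linarith)

theorem weight_le {d s : ℕ} (hd : 1 ≤ d) {B : Matrix (Fin d) (Fin d) ℝ} (hB : IsFrolovMatrix B)
    {t b : ℝ} (ht : 0 < t) (hb : 1 ≤ b) (hbd : b ^ d = 2) (y : Fin d → ℝ) :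
    ∑' k : Fin d → ℤ, (dilationPreimages B t b y).indicator
        (fun k => ENNReal.ofReal |∏ j, t * B.mulVec (intVec k) j|⁻¹) k ≤
      ENNReal.ofReal (3 / t ^ d) * ∑ j, ENNReal.ofReal ((|y j| / t) ^ s) ^ 2 := by
  obtain ⟨hfin, hcard⟩ := finite_dilationPreimages hB ht hb y
  set K := dilationPreimages B t b y with hK
  set p := ∏ j, |y j| / t with hp
  have hp0 : 0 ≤ p := Finset.prod_nonneg fun j _ => by positivity
  have htd : 0 < t ^ d := pow_pos ht d
  rw [tsum_eq_sum (s := hfin.toFinset) fun k hk =>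
    Set.indicator_of_notMem (fun h => hk (hfin.mem_toFinset.2 h)) _]
  have hterm : ∀ k ∈ hfin.toFinset, K.indicator
      (fun k => ENNReal.ofReal |∏ j, t * B.mulVec (intVec k) j|⁻¹) k ≤
        ENNReal.ofReal (3 / t ^ d / (p + 1)) := by
    intro k hk
    rw [hfin.mem_toFinset] at hk
    rw [Set.indicator_of_mem hk]
    refine ENNReal.ofReal_le_ofReal ?_
    have h1 : (1 : ℝ) ≤ |∏ j, B.mulVec (intVec k) j| := hB.one_le_prod k hk.1
    -- Together with `h1` this gives `p + 1 ≤ 3 |∏ (Bk)_j|`, the origin of the constant 3.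
    have h2 : p ≤ 2 * |∏ j, B.mulVec (intVec k) j| := by
      rw [hp, Finset.abs_prod, ← hbd]
      calc ∏ j, |y j| / t ≤ ∏ j, b * |B.mulVec (intVec k) j| :=
            Finset.prod_le_prod (fun j _ => by positivity) fun j _ =>
              (bounds_of_mem_dilationPreimages hB ht hk j).2
        _ = _ := by simp [Finset.prod_mul_distrib]
    have h3 : |∏ j, t * B.mulVec (intVec k) j| = t ^ d * |∏ j, B.mulVec (intVec k) j| := by
      rw [Finset.prod_mul_distrib, abs_mul]
      simp [abs_of_pos ht]
    rw [h3, div_div, inv_eq_one_div, div_le_div_iff₀ (by positivity) (by positivity)]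
    nlinarith
  refine (Finset.sum_le_sum hterm).trans ?_
  rw [Finset.sum_const, nsmul_eq_mul, ← Set.ncard_eq_toFinset_card K hfin]
  rcases K.eq_empty_or_nonempty with he | ⟨k, hk⟩
  · simp [he]
  have hsum : 1 ≤ ∑ j, ENNReal.ofReal ((|y j| / t) ^ s) ^ 2 := by
    -- If every `|y_j|/t` were below one, then `|∏ (Bk)_j| ≤ p ≤ |y_0|/t < 1`, contradicting the
    -- lower bound on the product at nonzero lattice points.
    obtain ⟨j, hj⟩ : ∃ j, 1 ≤ |y j| / t := by
      by_contra! hlt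
      have h1 : (1 : ℝ) ≤ |∏ j, B.mulVec (intVec k) j| := hB.one_le_prod k hk.1
      have h2 : |∏ j, B.mulVec (intVec k) j| ≤ p := by
        rw [Finset.abs_prod]
        exact Finset.prod_le_prod (fun j _ => abs_nonneg _) fun j _ =>
          (bounds_of_mem_dilationPreimages hB ht hk j).1
      have h3 : p ≤ |y ⟨0, hd⟩| / t := by
        rw [hp, ← Finset.mul_prod_erase _ _ (Finset.mem_univ (⟨0, hd⟩ : Fin d))]
        exact mul_le_of_le_one_right (by positivity) (Finset.prod_le_one
          (fun j _ => by positivity) fun j _ => (hlt j).le)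
      linarith [hlt ⟨0, hd⟩]
    have h1 : (1 : ℝ≥0∞) ≤ ENNReal.ofReal ((|y j| / t) ^ s) ^ 2 := by
      refine one_le_pow₀ ?_
      rw [ENNReal.one_le_ofReal]
      exact one_le_pow₀ hj
    exact h1.trans (Finset.single_le_sum (f := fun j => ENNReal.ofReal ((|y j| / t) ^ s) ^ 2)
      (fun _ _ => bot_le) (Finset.mem_univ j))
  calc (K.ncard : ℝ≥0∞) * ENNReal.ofReal (3 / t ^ d / (p + 1))
      = ENNReal.ofReal (K.ncard * (3 / t ^ d / (p + 1))) := by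
        rw [ENNReal.ofReal_mul (Nat.cast_nonneg _), ENNReal.ofReal_natCast]
    _ ≤ ENNReal.ofReal (3 / t ^ d) := by
        refine ENNReal.ofReal_le_ofReal ?_
        rw [mul_div_assoc', div_le_iff₀ (by positivity), mul_comm]
        gcongr
    _ ≤ _ := le_mul_of_one_le_right bot_le hsum

/-- The averaged sum of `|h|²` over a randomly dilated Frolov lattice is bounded by a weighted
integral of `h²`. -/
theorem lintegral_tsum_dilation_le {d s : ℕ} (hd : 1 ≤ d) {B : Matrix (Fin d) (Fin d) ℝ}
    (hB : IsFrolovMatrix B) {t b : ℝ} (ht : 0 < t) (hb : 1 ≤ b) (hbd : b ^ d = 2)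
    {h : (Fin d → ℝ) → ℝ≥0∞} (hh : Measurable h) :
    ∫⁻ u in Set.Icc (fun _ => (1 : ℝ)) (fun _ => b), (∑' k : Fin d → ℤ, if k = 0 then 0 else
        h (fun j => t * B.mulVec (intVec k) j * u j)) ≤
      ENNReal.ofReal (3 / t ^ d) *
        ∑ j, ∫⁻ y, ENNReal.ofReal ((|y j| / t) ^ s) ^ 2 * h y := by
  have hmeas : ∀ k : Fin d → ℤ, Measurable fun u : Fin d → ℝ =>
      if k = 0 then 0 else h (fun j => t * B.mulVec (intVec k) j * u j) := by
    intro k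
    split_ifs
    · exact measurable_const
    · exact hh.comp (by fun_prop)
  have hset : ∀ k : Fin d → ℤ, MeasurableSet {y : Fin d → ℝ | k ∈ dilationPreimages B t b y} := by
    intro k
    have : {y : Fin d → ℝ | k ∈ dilationPreimages B t b y} =
        {_y | k ≠ 0} ∩ ⋂ j, {y | y j / (t * B.mulVec (intVec k) j) ∈ Set.Icc 1 b} := by
      ext y; simp [dilationPreimages]
    rw [this]
    refine (MeasurableSet.const _).inter (MeasurableSet.iInter fun j => ?_)
    have : Measurable fun y : Fin d → ℝ => y j / (t * B.mulVec (intVec k) j) := by fun_prop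
    exact this measurableSet_Icc
  have hW : ∀ k : Fin d → ℤ, Measurable fun y : Fin d → ℝ => (dilationPreimages B t b y).indicator
      (fun k => ENNReal.ofReal |∏ j, t * B.mulVec (intVec k) j|⁻¹) k * h y := by
    intro k
    refine Measurable.mul ?_ hh
    exact Measurable.indicator (s := {y : Fin d → ℝ | k ∈ dilationPreimages B t b y})
      (f := fun _ => ENNReal.ofReal |∏ j, t * B.mulVec (intVec k) j|⁻¹) measurable_const (hset k)
  rw [lintegral_tsum fun k => (hmeas k).aemeasurable]
  -- Substituting `y_j = t (Bk)_j u_j`: the Jacobian becomes the weight and the image of the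
  -- dilation cube becomes the indicator.
  have hk : ∀ k : Fin d → ℤ, ∫⁻ u in Set.Icc (fun _ => (1 : ℝ)) (fun _ => b), (if k = 0 then 0 else
      h (fun j => t * B.mulVec (intVec k) j * u j)) =
        ∫⁻ y, (dilationPreimages B t b y).indicator
          (fun k => ENNReal.ofReal |∏ j, t * B.mulVec (intVec k) j|⁻¹) k * h y := by
    intro k
    by_cases hk : k = 0
    · have : ∀ y, k ∉ dilationPreimages B t b y := fun y hy => hy.1 hk
      simp [hk ▸ this, hk]
    · simp only [if_neg hk]
      rw [setLIntegral_comp_dilation (D := fun j => t * B.mulVec (intVec k) j)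
        (fun j => mul_ne_zero ht.ne' (mulVec_intVec_ne_zero hB hk j)) measurableSet_Icc hh,
        ← lintegral_const_mul' _ _ ENNReal.ofReal_ne_top]
      refine lintegral_congr fun y => ?_
      have hiff : y ∈ {y : Fin d → ℝ | (fun j => y j / (t * B.mulVec (intVec k) j)) ∈
          Set.Icc (fun _ => (1 : ℝ)) (fun _ => b)} ↔ k ∈ dilationPreimages B t b y := by
        simp only [Set.mem_Icc, Pi.le_def, dilationPreimages, Set.mem_ofPred_eq, ne_eq, hk,
          not_false_eq_true, true_and, forall_and]
      by_cases hy : k ∈ dilationPreimages B t b y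
      · rw [Set.indicator_of_mem hy, Set.indicator_of_mem (hiff.2 hy)]
      · rw [Set.indicator_of_notMem hy, Set.indicator_of_notMem (fun h' => hy (hiff.1 h'))]
        simp
  simp only [hk]
  rw [← lintegral_tsum fun k => (hW k).aemeasurable, ← lintegral_finsetSum _ fun j _ => by fun_prop,
    ← lintegral_const_mul' _ _ ENNReal.ofReal_ne_top]
  refine lintegral_mono fun y => ?_
  rw [ENNReal.tsum_mul_right, ← Finset.sum_mul, ← mul_assoc]
  gcongr
  exact weight_le hd hB ht hb hbd y

/-! ### Weak derivatives of functions supported in the cube and their Fourier transforms. -/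

section WeakDeriv

open scoped ContDiff Topology

/-- Locality of differentiation, needed so that cutting off a plane wave far from the cube leaves
its derivatives on the cube unchanged. -/
theorem partialDeriv_congr {d : ℕ} (i : Fin d) {φ ψ : EuclideanSpace ℝ (Fin d) → ℝ}
    {x : EuclideanSpace ℝ (Fin d)} (h : φ =ᶠ[𝓝 x] ψ) :
    partialDeriv i φ =ᶠ[𝓝 x] partialDeriv i ψ := by
  filter_upwards [h.fderiv (𝕜 := ℝ)] with z hz
  simp only [partialDeriv, hz]

theorem iterate_partialDeriv_congr {d : ℕ} (i : Fin d) (n : ℕ)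
    {φ ψ : EuclideanSpace ℝ (Fin d) → ℝ} {x : EuclideanSpace ℝ (Fin d)} (h : φ =ᶠ[𝓝 x] ψ) :
    (partialDeriv i)^[n] φ =ᶠ[𝓝 x] (partialDeriv i)^[n] ψ := by
  induction n with
  | zero => exact h
  | succ n ih =>
    rw [Function.iterate_succ_apply', Function.iterate_succ_apply']
    exact partialDeriv_congr i ih

theorem multiDeriv_congr {d : ℕ} (α : Fin d → ℕ) {φ ψ : EuclideanSpace ℝ (Fin d) → ℝ}
    {x : EuclideanSpace ℝ (Fin d)} (h : φ =ᶠ[𝓝 x] ψ) :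
    multiDeriv α φ =ᶠ[𝓝 x] multiDeriv α ψ := by
  unfold multiDeriv
  induction List.finRange d with
  | nil => exact h
  | cons i l ih => exact iterate_partialDeriv_congr i (α i) ih

theorem multiDeriv_zero_fun {d : ℕ} (α : Fin d → ℕ) :
    multiDeriv α (0 : EuclideanSpace ℝ (Fin d) → ℝ) = 0 := by
  have h1 : ∀ i : Fin d, partialDeriv i (0 : EuclideanSpace ℝ (Fin d) → ℝ) = 0 := by
    intro i; ext x; simp [partialDeriv]
  unfold multiDeriv
  induction List.finRange d with
  | nil => rfl
  | cons i l ih =>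
    rw [List.foldr_cons, ih]
    exact Function.iterate_fixed (h1 i) _

theorem multiDeriv_eq_zero_of_notMem_tsupport {d : ℕ} (α : Fin d → ℕ)
    {φ : EuclideanSpace ℝ (Fin d) → ℝ} {x : EuclideanSpace ℝ (Fin d)} (hx : x ∉ tsupport φ) :
    multiDeriv α φ x = 0 := by
  have := multiDeriv_congr α (notMem_tsupport_iff_eventuallyEq.1 hx)
  rw [multiDeriv_zero_fun] at this
  exact this.eq_of_nhds

theorem multiDeriv_single {d : ℕ} (j : Fin d) (s : ℕ) (φ : EuclideanSpace ℝ (Fin d) → ℝ) :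
    multiDeriv (Pi.single j s) φ = (partialDeriv j)^[s] φ := by
  have key : ∀ l : List (Fin d), l.Nodup →
      l.foldr (fun i ψ => (partialDeriv i)^[(Pi.single j s : Fin d → ℕ) i] ψ) φ =
        if j ∈ l then (partialDeriv j)^[s] φ else φ := by
    intro l hl
    induction l with
    | nil => simp
    | cons i l ih =>
      rw [List.nodup_cons] at hl
      rw [List.foldr_cons, ih hl.2]
      by_cases hij : i = j
      · subst hij
        simp [hl.1]
      · simp [Ne.symm hij]
  have := key (List.finRange d) (List.nodup_finRange d)
  simpa [multiDeriv] using this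

/-- A test function supported in the smaller set vanishes outside it with all its derivatives, so
the integrals over both sets agree. -/
theorem IsWeakDeriv.mono {d : ℕ} {O O' : Set (EuclideanSpace ℝ (Fin d))} {α : Fin d → ℕ}
    {f g : EuclideanSpace ℝ (Fin d) → ℝ} (h : IsWeakDeriv O α f g) (hO : O' ⊆ O) :
    IsWeakDeriv O' α f g := by
  refine ⟨h.1.mono_set hO, h.2.mono_set hO, fun φ hφ hc hs => ?_⟩
  have key : ∀ u v : EuclideanSpace ℝ (Fin d) → ℝ, (∀ x, x ∉ tsupport φ → v x = 0) →
      ∫ x in O', u x * v x = ∫ x in O, u x * v x := by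
    intro u v hv
    rw [setIntegral_eq_integral_of_forall_compl_eq_zero,
      setIntegral_eq_integral_of_forall_compl_eq_zero]
    · intro x hx; rw [hv x fun h' => hx (hO (hs h')), mul_zero]
    · intro x hx; rw [hv x fun h' => hx (hs h'), mul_zero]
  rw [key f _ fun x => multiDeriv_eq_zero_of_notMem_tsupport α,
    key g _ fun x => image_eq_zero_of_notMem_tsupport]
  exact h.3 φ hφ hc (hs.trans hO)

theorem isClosed_unitCube (d : ℕ) : IsClosed (unitCube d) := by
  have : unitCube d = ⋂ i, {x | x i ∈ Set.Icc (0 : ℝ) 1} := by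
    ext x; simp [unitCube]
  rw [this]
  refine isClosed_iInter fun i => IsClosed.preimage ?_ isClosed_Icc
  fun_prop

theorem isOpen_openUnitCube (d : ℕ) : IsOpen (openUnitCube d) := by
  have : openUnitCube d = ⋂ i, {x | x i ∈ Set.Ioo (0 : ℝ) 1} := by
    ext x; simp [openUnitCube]
  rw [this]
  refine isOpen_iInter_of_finite fun i => IsOpen.preimage ?_ isOpen_Ioo
  fun_prop

theorem norm_le_of_mem_unitCube {d : ℕ} {x : EuclideanSpace ℝ (Fin d)} (hx : x ∈ unitCube d) :
    ‖x‖ ≤ d := by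
  rw [EuclideanSpace.norm_eq]
  refine Real.sqrt_le_iff.2 ⟨Nat.cast_nonneg _, ?_⟩
  calc ∑ i, ‖x i‖ ^ 2 ≤ ∑ _i : Fin d, (1 : ℝ) := by
        refine Finset.sum_le_sum fun i _ => ?_
        rw [Real.norm_eq_abs, sq_abs]
        exact pow_le_one₀ (hx i).1 (hx i).2
    _ ≤ (d : ℝ) ^ 2 := by
        simp only [Finset.sum_const, Finset.card_univ, Fintype.card_fin, nsmul_eq_mul, mul_one]
        rcases Nat.eq_zero_or_pos d with h | h
        · simp [h]
        · have : (1 : ℝ) ≤ d := by exact_mod_cast h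
          nlinarith

theorem ae_mem_openUnitCube_of_mem_unitCube (d : ℕ) :
    ∀ᵐ x : EuclideanSpace ℝ (Fin d), x ∈ unitCube d → x ∈ openUnitCube d := by
  have h := Measure.univ_pi_Ioo_ae_eq_Icc (μ := fun _ : Fin d => (volume : Measure ℝ))
    (f := fun _ => 0) (g := fun _ => 1)
  have h2 : ∀ᵐ z : Fin d → ℝ, z ∈ Set.Icc (fun _ => (0 : ℝ)) (fun _ => 1) →
      z ∈ Set.pi Set.univ fun _ => Set.Ioo (0 : ℝ) 1 := by
    filter_upwards [h] with z hz hz'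
    exact (iff_of_eq hz).2 hz'
  have h3 := (PiLp.volume_preserving_ofLp (Fin d)).quasiMeasurePreserving.ae h2
  filter_upwards [h3] with x hx hx'
  have := hx (by
    rw [Set.mem_Icc]
    exact ⟨fun i => (hx' i).1, fun i => (hx' i).2⟩)
  exact fun i => this i (Set.mem_univ i)

/-- A weak derivative of a function supported in the unit cube vanishes off the open unit cube. -/
theorem IsWeakDeriv.ae_eq_zero_off_cube {d : ℕ} {α : Fin d → ℕ}
    {f g : EuclideanSpace ℝ (Fin d) → ℝ} (h : IsWeakDeriv Set.univ α f g)
    (hf : tsupport f ⊆ unitCube d) : ∀ᵐ x, x ∉ openUnitCube d → g x = 0 := by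
  have hO : IsOpen (unitCube d)ᶜ := (isClosed_unitCube d).isOpen_compl
  -- On the open complement of the cube `f` is zero, so uniqueness of weak derivatives compares `g`
  -- with `0` there; the boundary of the cube is a null set.
  have hz : IsWeakDeriv (unitCube d)ᶜ α f 0 := by
    have h' := h.mono (Set.subset_univ (unitCube d)ᶜ)
    refine ⟨h'.1, (locallyIntegrable_zero).locallyIntegrableOn _, fun φ _ _ _ => ?_⟩
    simp only [Pi.zero_apply, zero_mul, integral_zero, mul_zero]
    refine setIntegral_eq_zero_of_forall_eq_zero fun x hx => ?_
    rw [image_eq_zero_of_notMem_tsupport fun h' => hx (hf h'), zero_mul]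
  have h1 := (ae_restrict_iff' hO.measurableSet).1
    ((h.mono (Set.subset_univ (unitCube d)ᶜ)).ae_eq hO hz)
  filter_upwards [h1, ae_mem_openUnitCube_of_mem_unitCube d] with x hx hx' hxo
  exact hx fun hc => hxo (hx' hc)

/-- The plane wave `x ↦ cos (2π y·x + θ)`. -/
noncomputable def cosWave {d : ℕ} (y : Fin d → ℝ) (θ : ℝ) (x : EuclideanSpace ℝ (Fin d)) : ℝ :=
  Real.cos (2 * Real.pi * (y ⬝ᵥ x.ofLp) + θ)

theorem contDiff_cosWave {d : ℕ} (y : Fin d → ℝ) (θ : ℝ) : ContDiff ℝ ∞ (cosWave y θ) := by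
  unfold cosWave dotProduct
  fun_prop

/-- With a free phase, differentiation is a quarter-period shift, so real cosines suffice and sines
need no separate treatment. -/
theorem partialDeriv_const_mul_cosWave {d : ℕ} (j : Fin d) (y : Fin d → ℝ) (c θ : ℝ) :
    partialDeriv j (fun x => c * cosWave y θ x) =
      fun x => (c * (2 * Real.pi * y j)) * cosWave y (θ + Real.pi / 2) x := by
  ext x
  have hd : DifferentiableAt ℝ (fun x => c * cosWave y θ x) x :=
    ((contDiff_cosWave y θ).differentiable (by simp)).differentiableAt.const_mul c
  have h1 := hd.hasFDerivAt.hasLineDerivAt (EuclideanSpace.single j 1)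
  have h2 : HasDerivAt (fun r : ℝ => c * Real.cos (2 * Real.pi * (y ⬝ᵥ x.ofLp) + θ +
      r * (2 * Real.pi * y j))) (c * (-Real.sin (2 * Real.pi * (y ⬝ᵥ x.ofLp) + θ +
        0 * (2 * Real.pi * y j)) * (1 * (2 * Real.pi * y j)))) 0 :=
    ((((hasDerivAt_id (0 : ℝ)).mul_const _).const_add _).cos).const_mul c
  have h3 : (fun r : ℝ => c * cosWave y θ (x + r • EuclideanSpace.single j 1)) =
      fun r : ℝ => c * Real.cos (2 * Real.pi * (y ⬝ᵥ x.ofLp) + θ + r * (2 * Real.pi * y j)) := by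
    ext r
    have : y ⬝ᵥ (x + r • EuclideanSpace.single j (1 : ℝ)).ofLp = y ⬝ᵥ x.ofLp + r * y j := by
      simp [dotProduct_add]
    rw [cosWave, this]
    congr 2; ring
  rw [HasLineDerivAt, h3] at h1
  rw [partialDeriv, h1.unique h2, cosWave, ← add_assoc, Real.cos_add_pi_div_two, zero_mul, add_zero]
  ring

theorem iterate_partialDeriv_cosWave {d : ℕ} (j : Fin d) (y : Fin d → ℝ) (θ : ℝ) (s : ℕ) :
    (partialDeriv j)^[s] (cosWave y θ) =
      fun x => (2 * Real.pi * y j) ^ s * cosWave y (θ + s * (Real.pi / 2)) x := by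
  induction s with
  | zero => ext x; simp
  | succ s ih =>
    rw [Function.iterate_succ_apply', ih, partialDeriv_const_mul_cosWave]
    ext x
    rw [pow_succ]
    congr 2
    push_cast; ring

/-- Weak derivatives of functions supported in the unit cube can be tested against plane waves. -/
theorem IsWeakDeriv.integral_cosWave {d s : ℕ} {j : Fin d} {f g : EuclideanSpace ℝ (Fin d) → ℝ}
    (h : IsWeakDeriv Set.univ (Pi.single j s) f g) (hf : tsupport f ⊆ unitCube d)
    (y : Fin d → ℝ) (θ : ℝ) :
    ∫ x, g x * cosWave y θ x =
      (-1) ^ s * (2 * Real.pi * y j) ^ s * ∫ x, f x * cosWave y (θ + s * (Real.pi / 2)) x := by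
  -- Points of the cube have norm at most `d`, so the cutoff is one near the cube and makes the
  -- plane wave an admissible test function.
  let χ : ContDiffBump (0 : EuclideanSpace ℝ (Fin d)) :=
    ⟨d + 1, d + 2, by positivity, by linarith⟩
  have hball : ∀ x ∈ unitCube d, x ∈ Metric.ball (0 : EuclideanSpace ℝ (Fin d)) χ.rIn := by
    intro x hx
    rw [mem_ball_zero_iff]
    exact (norm_le_of_mem_unitCube hx).trans_lt (by simp [χ])
  have hχ : ∀ x ∈ unitCube d, (fun x => χ x * cosWave y θ x) =ᶠ[𝓝 x] cosWave y θ := by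
    intro x hx
    filter_upwards [χ.eventuallyEq_one_of_mem_ball (hball x hx)] with z hz
    simp [hz]
  have key := h.integral_eq (fun x => χ x * cosWave y θ x)
    (χ.contDiff.mul (contDiff_cosWave y θ)) χ.hasCompactSupport.mul_right (Set.subset_univ _)
  have hsum : ∑ i, (Pi.single j s : Fin d → ℕ) i = s := by simp
  rw [hsum, Measure.restrict_univ] at key
  have h1 : ∫ x, f x * multiDeriv (Pi.single j s) (fun x => χ x * cosWave y θ x) x =
      (2 * Real.pi * y j) ^ s * ∫ x, f x * cosWave y (θ + s * (Real.pi / 2)) x := by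
    rw [← integral_const_mul]
    refine integral_congr_ae (Filter.Eventually.of_forall fun x => ?_)
    by_cases hx : x ∈ unitCube d
    · have := (multiDeriv_congr (Pi.single j s) (hχ x hx)).eq_of_nhds
      rw [multiDeriv_single, multiDeriv_single, iterate_partialDeriv_cosWave] at this
      simp only [multiDeriv_single, this]
      ring
    · simp [image_eq_zero_of_notMem_tsupport fun h' => hx (hf h')]
  have h2 : ∫ x, g x * (χ x * cosWave y θ x) = ∫ x, g x * cosWave y θ x := by
    refine integral_congr_ae ?_
    filter_upwards [h.ae_eq_zero_off_cube hf] with x hx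
    by_cases hxo : x ∈ unitCube d
    · rw [(hχ x hxo).eq_of_nhds]
    · rw [hx fun h' => hxo fun i => Set.Ioo_subset_Icc_self (h' i)]
      simp
  rw [h1, h2] at key
  rw [mul_assoc, key, ← mul_assoc, ← mul_pow]
  norm_num

theorem exp_mul_fourierInt {d : ℕ} {g : EuclideanSpace ℝ (Fin d) → ℝ} (hg : Integrable g)
    (y : Fin d → ℝ) (θ : ℝ) :
    Complex.exp (-θ * Complex.I) * fourierInt (toPi g) y =
      ((∫ x, g x * cosWave y θ x : ℝ) : ℂ) +
        ((∫ x, g x * cosWave y (θ + Real.pi / 2) x : ℝ) : ℂ) * Complex.I := by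
  have h1 : fourierInt (toPi g) y =
      ∫ x : EuclideanSpace ℝ (Fin d), character y x.ofLp * (g x : ℂ) := by
    rw [← integral_comp_toLp]; rfl
  have hint : ∀ θ, Integrable (fun x => ((g x * cosWave y θ x : ℝ) : ℂ)) := by
    intro θ
    refine Integrable.ofReal ?_
    refine hg.mul_bdd (c := 1) (contDiff_cosWave y θ).continuous.aestronglyMeasurable
      (Filter.Eventually.of_forall fun x => ?_)
    exact Real.abs_cos_le_one _
  rw [h1, ← integral_const_mul, ← integral_complex_ofReal, ← integral_complex_ofReal,
    ← integral_mul_const, ← integral_add (hint θ) ((hint _).mul_const _)]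
  refine integral_congr_ae (Filter.Eventually.of_forall fun x => ?_)
  set a := 2 * Real.pi * (y ⬝ᵥ x.ofLp) with ha
  have h2 : Complex.exp (-θ * Complex.I) * character y x.ofLp =
      Complex.exp (((-(a + θ) : ℝ) : ℂ) * Complex.I) := by
    rw [character, ← ha, ← Complex.exp_add]
    congr 1; push_cast; ring
  have h3 : cosWave y (θ + Real.pi / 2) x = -Real.sin (a + θ) := by
    rw [cosWave, ← add_assoc, Real.cos_add_pi_div_two]
  have h4 : cosWave y θ x = Real.cos (a + θ) := rfl
  simp only [h3, h4]
  rw [← mul_assoc, h2, Complex.exp_mul_I, ← Complex.ofReal_cos, ← Complex.ofReal_sin, Real.cos_neg,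
    Real.sin_neg]
  push_cast; ring

theorem volume_unitCube_ne_top (d : ℕ) : volume (unitCube d) ≠ ⊤ := by
  have : unitCube d ⊆ Metric.closedBall 0 d := fun x hx => by
    rw [mem_closedBall_zero_iff]; exact norm_le_of_mem_unitCube hx
  exact ((measure_mono this).trans_lt measure_closedBall_lt_top).ne

theorem integrable_of_ae_eq_zero_off_cube {d : ℕ} {g : EuclideanSpace ℝ (Fin d) → ℝ}
    (hg : MemLp g 2 volume) (h0 : ∀ᵐ x, x ∉ openUnitCube d → g x = 0) : Integrable g := by
  have hO : openUnitCube d ⊆ unitCube d := fun x hx i => Set.Ioo_subset_Icc_self (hx i)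
  have : IsFiniteMeasure (volume.restrict (openUnitCube d)) :=
    ⟨by
      rw [Measure.restrict_apply_univ]
      exact (measure_mono hO).trans_lt (volume_unitCube_ne_top d).lt_top⟩
  have h1 : IntegrableOn g (openUnitCube d) := (hg.restrict _).integrable (by norm_num)
  exact IntegrableOn.integrable_of_ae_notMem_eq_zero h1 h0

/-- Testing `g` against cosines of phases `0` and `π/2` gives integrals of `f` with phases shifted
by `sπ/2`. They recombine to `f̂(y)` times a unimodular constant and `(-2πy_j)^s`. -/
theorem norm_fourierInt_weakDeriv {d s : ℕ} {j : Fin d} {f g : EuclideanSpace ℝ (Fin d) → ℝ}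
    (h : IsWeakDeriv Set.univ (Pi.single j s) f g) (hf : tsupport f ⊆ unitCube d)
    (hfi : Integrable f) (hgi : Integrable g) (y : Fin d → ℝ) :
    ‖fourierInt (toPi g) y‖ = |2 * Real.pi * y j| ^ s * ‖fourierInt (toPi f) y‖ := by
  have h1 := exp_mul_fourierInt hgi y 0
  have h2 := exp_mul_fourierInt hfi y (s * (Real.pi / 2))
  rw [h.integral_cosWave hf, h.integral_cosWave hf, zero_add, zero_add,
    add_comm (Real.pi / 2)] at h1
  simp only [Complex.ofReal_zero, neg_zero, zero_mul, Complex.exp_zero, one_mul,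
    Complex.ofReal_mul ((-1) ^ s * (2 * Real.pi * y j) ^ s)] at h1
  rw [mul_assoc (((-1) ^ s * (2 * Real.pi * y j) ^ s : ℝ) : ℂ), ← mul_add, ← h2] at h1
  have h3 : ‖Complex.exp (-((s * (Real.pi / 2) : ℝ) : ℂ) * Complex.I)‖ = 1 := by
    rw [← Complex.ofReal_neg]; exact Complex.norm_exp_ofReal_mul_I _
  rw [h1, norm_mul, norm_mul, h3, one_mul, Complex.norm_real]
  simp

theorem memLp_toPi {d : ℕ} {g : EuclideanSpace ℝ (Fin d) → ℝ} (hg : MemLp g 2 volume) :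
    MemLp (toPi g) 2 volume :=
  (hg.comp_measurePreserving (PiLp.volume_preserving_toLp (Fin d))).ofReal

theorem lintegral_toPi_sq {d : ℕ} {g : EuclideanSpace ℝ (Fin d) → ℝ} :
    ∫⁻ x, ‖toPi g x‖ₑ ^ 2 = ∫⁻ x, ‖g x‖ₑ ^ 2 := by
  have h := (PiLp.volume_preserving_toLp (Fin d)).lintegral_comp_emb
    (MeasurableEquiv.toLp 2 (Fin d → ℝ)).measurableEmbedding (fun x => ‖g x‖ₑ ^ 2)
  rw [← h]
  refine lintegral_congr fun x => ?_
  rw [toPi, ← ofReal_norm, ← ofReal_norm, Complex.norm_real]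

theorem lintegral_pow_mul_fourierInt_sq_le {d s : ℕ} {f : EuclideanSpace ℝ (Fin d) → ℝ}
    (hf : f ∈ sobolevZero d s) (j : Fin d) :
    ∫⁻ y, ENNReal.ofReal (|y j| ^ s) ^ 2 * ‖fourierInt (toPi f) y‖ₑ ^ 2 ≤
      ENNReal.ofReal (sobolevNorm (openUnitCube d) s f ^ 2) := by
  obtain ⟨hfc, ⟨hf2, hder⟩, hsupp⟩ := hf
  rw [Measure.restrict_univ] at hf2
  have hα : (Pi.single j s : Fin d → ℕ) ∈ multiIndices d s := mem_multiIndices.2 (by simp)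
  obtain ⟨g, hg, hg2⟩ := hder _ hα
  rw [Measure.restrict_univ] at hg2
  have hf0 : ∀ᵐ x, x ∉ openUnitCube d → f x = 0 := by
    filter_upwards [ae_mem_openUnitCube_of_mem_unitCube d] with x hx hxo
    exact image_eq_zero_of_notMem_tsupport fun h' => hxo (hx (hsupp h'))
  have hg0 := hg.ae_eq_zero_off_cube hsupp
  have hfi := integrable_of_ae_eq_zero_off_cube hf2 hf0
  have hgi := integrable_of_ae_eq_zero_off_cube hg2 hg0
  have hgbox : ∀ᵐ x : Fin d → ℝ, x ∉ halfOpenBox d → toPi g x = 0 := by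
    filter_upwards [(PiLp.volume_preserving_toLp (Fin d)).quasiMeasurePreserving.ae hg0] with x hx hxb
    have : g (WithLp.toLp 2 x) = 0 := hx fun h' => hxb fun i => Set.Ioo_subset_Ioc_self (h' i)
    rw [toPi, this, Complex.ofReal_zero]
  have hO := (isOpen_openUnitCube d).measurableSet
  -- The norm uses a chosen weak derivative on the open cube; uniqueness identifies it with `g`
  -- almost everywhere there.
  have hge : weakDeriv (openUnitCube d) (Pi.single j s) f =ᵐ[volume.restrict (openUnitCube d)] g := by
    have hex : ∃ g, IsWeakDeriv (openUnitCube d) (Pi.single j s) f g :=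
      ⟨g, hg.mono (Set.subset_univ _)⟩
    have := hex.choose_spec.ae_eq (isOpen_openUnitCube d) (hg.mono (Set.subset_univ _))
    rwa [weakDeriv, dif_pos hex]
  calc ∫⁻ y, ENNReal.ofReal (|y j| ^ s) ^ 2 * ‖fourierInt (toPi f) y‖ₑ ^ 2
      ≤ ∫⁻ y, ‖fourierInt (toPi g) y‖ₑ ^ 2 := by
        refine lintegral_mono fun y => ?_
        rw [← mul_pow]
        gcongr
        rw [← ofReal_norm, ← ofReal_norm, ← ENNReal.ofReal_mul (by positivity),
          norm_fourierInt_weakDeriv hg hsupp hfi hgi]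
        refine ENNReal.ofReal_le_ofReal ?_
        refine mul_le_mul_of_nonneg_right (pow_le_pow_left₀ (abs_nonneg _) ?_ s) (norm_nonneg _)
        rw [abs_mul]
        refine le_mul_of_one_le_left (abs_nonneg _) ?_
        rw [abs_of_pos (by positivity)]
        linarith [Real.pi_gt_three]
    _ = ∫⁻ x, ‖toPi g x‖ₑ ^ 2 := lintegral_fourierInt_sq (memLp_toPi hg2) hgbox
    _ = ∫⁻ x, ‖g x‖ₑ ^ 2 := lintegral_toPi_sq
    _ = ENNReal.ofReal (∫ x, g x ^ 2) := by
        rw [ofReal_integral_eq_lintegral_ofReal hg2.integrable_sq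
          (Filter.Eventually.of_forall fun x => sq_nonneg _)]
        refine lintegral_congr fun x => ?_
        rw [← ofReal_norm, ← ENNReal.ofReal_pow (norm_nonneg _), Real.norm_eq_abs, sq_abs]
    _ ≤ ENNReal.ofReal (sobolevNorm (openUnitCube d) s f ^ 2) := by
        refine ENNReal.ofReal_le_ofReal ?_
        have h1 : ∫ x, g x ^ 2 =
            ∫ x in openUnitCube d, weakDeriv (openUnitCube d) (Pi.single j s) f x ^ 2 := by
          rw [← setIntegral_eq_integral_of_ae_compl_eq_zero (s := openUnitCube d)]
          · refine integral_congr_ae ?_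
            filter_upwards [hge] with x hx
            rw [hx]
          · filter_upwards [hg0] with x hx hxo
            rw [hx hxo]; norm_num
        have hnn : ∀ α ∈ multiIndices d s,
            0 ≤ ∫ x in openUnitCube d, weakDeriv (openUnitCube d) α f x ^ 2 :=
          fun α _ => integral_nonneg fun x => sq_nonneg _
        rw [h1, sobolevNorm, Real.sq_sqrt (Finset.sum_nonneg hnn)]
        exact Finset.single_le_sum (f := fun α =>
          ∫ x in openUnitCube d, weakDeriv (openUnitCube d) α f x ^ 2) hnn hα

end WeakDeriv

/-! ### Assembling the bound for the random rule. -/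

theorem hasCompactSupport_of_mem_sobolevZero {d s : ℕ} {f : EuclideanSpace ℝ (Fin d) → ℝ}
    (hf : f ∈ sobolevZero d s) : HasCompactSupport f := by
  refine HasCompactSupport.of_support_subset_isCompact (K := Metric.closedBall 0 d)
    (isCompact_closedBall _ _) fun x hx => ?_
  rw [mem_closedBall_zero_iff]
  exact norm_le_of_mem_unitCube (hf.2.2 (subset_tsupport f hx))

theorem dilatedMatrix_mulVec {d : ℕ} (n : ℕ) (u k : Fin d → ℝ) (B : Matrix (Fin d) (Fin d) ℝ) :
    (dilatedMatrix n u B).mulVec k = fun j => (n : ℝ) ^ (1 / (d : ℝ)) * B.mulVec k j * u j := by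
  ext j
  rw [dilatedMatrix, Matrix.smul_mulVec, ← Matrix.mulVec_mulVec, Pi.smul_apply,
    Matrix.mulVec_diagonal, smul_eq_mul]
  ring

theorem det_dilatedMatrix_ne_zero {d n : ℕ} (hn : 1 ≤ n) {u : Fin d → ℝ} (hu : ∀ j, u j ≠ 0)
    {B : Matrix (Fin d) (Fin d) ℝ} (hB : IsUnit B) : (dilatedMatrix n u B).det ≠ 0 := by
  rw [dilatedMatrix, Matrix.det_smul, Matrix.det_mul, Matrix.det_diagonal]
  have h1 : (0 : ℝ) < n := by exact_mod_cast hn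
  have h2 := ((Matrix.isUnit_iff_isUnit_det B).1 hB).ne_zero
  exact mul_ne_zero (pow_ne_zero _ (Real.rpow_pos_of_pos h1 _).ne')
    (mul_ne_zero (Finset.prod_ne_zero_iff.2 fun j _ => hu j) h2)

/-- Joint measurability in `(u, v)` is needed to pass to the joint law and apply Tonelli. Writing
the inverse through determinant and adjugate gives it at singular matrices too. -/
theorem measurable_quadRule_dilatedMatrix {d n : ℕ} {B : Matrix (Fin d) (Fin d) ℝ}
    {f : EuclideanSpace ℝ (Fin d) → ℝ} (hf : Continuous f) :
    Measurable fun p : (Fin d → ℝ) × (Fin d → ℝ) => quadRule (dilatedMatrix n p.1 B) p.2 f := by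
  have hS : Continuous fun p : (Fin d → ℝ) × (Fin d → ℝ) => dilatedMatrix n p.1 B := by
    unfold dilatedMatrix
    have h : Continuous fun p : (Fin d → ℝ) × (Fin d → ℝ) => Matrix.diagonal p.1 * B :=
      (continuous_fst.matrix_diagonal).matrix_mul continuous_const
    exact h.const_smul ((n : ℝ) ^ (1 / (d : ℝ)))
  have hinv : ∀ i j, Measurable fun p : (Fin d → ℝ) × (Fin d → ℝ) =>
      (dilatedMatrix n p.1 B)⁻¹ i j := by
    intro i j
    simp only [Matrix.inv_def, Ring.inverse_eq_inv', Matrix.smul_apply, smul_eq_mul]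
    exact hS.matrix_det.measurable.inv.mul (hS.matrix_adjugate.matrix_elem i j).measurable
  unfold quadRule
  refine Measurable.mul (hS.matrix_det.abs.measurable.const_div 1) (Measurable.tsum fun m => ?_)
  refine hf.measurable.comp ((PiLp.continuous_toLp 2 _).measurable.comp
    (measurable_pi_lambda _ fun i => ?_))
  simp only [Matrix.mulVec, dotProduct, Matrix.transpose_apply]
  exact Finset.measurable_sum _ fun j _ => (hinv j i).mul (by fun_prop)

theorem cond_Icc_zero_one (d : ℕ) :
    ProbabilityTheory.cond (volume : Measure (Fin d → ℝ))
      (Set.Icc (fun _ => (0 : ℝ)) fun _ => (1 : ℝ)) = volume.restrict (halfOpenBox d) := by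
  have h1 : volume (Set.Icc (fun _ : Fin d => (0 : ℝ)) fun _ => (1 : ℝ)) = 1 := by
    rw [Real.volume_Icc_pi]; simp
  rw [ProbabilityTheory.cond, h1, inv_one, one_smul, halfOpenBox_eq_pi]
  exact Measure.restrict_congr_set (Measure.univ_pi_Ioc_ae_eq_Icc
    (μ := fun _ : Fin d => (volume : Measure ℝ)) (f := fun _ => 0) (g := fun _ => 1)).symm

/-- The mean square error of the randomly dilated and shifted Frolov rule. -/
theorem lintegral_lintegral_quadRule_sub_sq_le {d s n : ℕ} (hd : 1 ≤ d) (hn : 1 ≤ n)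
    {B : Matrix (Fin d) (Fin d) ℝ} (hB : IsFrolovMatrix B)
    {f : EuclideanSpace ℝ (Fin d) → ℝ} (hf : f ∈ sobolevZero d s) :
    ∫⁻ u in Set.Icc (fun _ => (1 : ℝ)) (fun _ => (2 : ℝ) ^ (1 / (d : ℝ))),
      ∫⁻ v in halfOpenBox d, ‖quadRule (dilatedMatrix n u B) v f - ∫ x, f x‖ₑ ^ 2 ≤
        ENNReal.ofReal (3 * d * ((n : ℝ) ^ (-(s : ℝ) / (d : ℝ) - 1 / 2)) ^ 2 *
          sobolevNorm (openUnitCube d) s f ^ 2) := by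
  have hd0 : (d : ℝ) ≠ 0 := by positivity
  have hn0 : (0 : ℝ) < n := by exact_mod_cast hn
  set t : ℝ := (n : ℝ) ^ (1 / (d : ℝ)) with ht_def
  set b : ℝ := (2 : ℝ) ^ (1 / (d : ℝ)) with hb_def
  set N := sobolevNorm (openUnitCube d) s f
  have ht : 0 < t := Real.rpow_pos_of_pos hn0 _
  have htd : t ^ d = n := by
    rw [ht_def, ← Real.rpow_natCast, ← Real.rpow_mul hn0.le, one_div_mul_cancel hd0, Real.rpow_one]
  have hbd : b ^ d = 2 := by
    rw [hb_def, ← Real.rpow_natCast, ← Real.rpow_mul (by norm_num), one_div_mul_cancel hd0,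
      Real.rpow_one]
  have hb : 1 ≤ b := Real.one_le_rpow (by norm_num) (by positivity)
  have hmeas := measurable_fourierInt (continuous_toPi hf.1).aestronglyMeasurable
  have h1 : ∀ u ∈ Set.Icc (fun _ : Fin d => (1 : ℝ)) (fun _ => b),
      ∫⁻ v in halfOpenBox d, ‖quadRule (dilatedMatrix n u B) v f - ∫ x, f x‖ₑ ^ 2 =
        ∑' k : Fin d → ℤ, if k = 0 then 0 else
          ‖fourierInt (toPi f) (fun j => t * B.mulVec (intVec k) j * u j)‖ₑ ^ 2 := by
    intro u hu
    have hu0 : ∀ j, u j ≠ 0 := fun j => (zero_lt_one.trans_le (hu.1 j)).ne'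
    rw [lintegral_quadRule_sub_sq (det_dilatedMatrix_ne_zero hn hu0 hB.isUnit) hf.1
      (hasCompactSupport_of_mem_sobolevZero hf)]
    simp only [dilatedMatrix_mulVec]
    rfl
  rw [setLIntegral_congr_fun measurableSet_Icc h1]
  refine (lintegral_tsum_dilation_le (s := s) hd hB ht hb hbd
    (h := fun y => ‖fourierInt (toPi f) y‖ₑ ^ 2) (by fun_prop)).trans ?_
  have h2 : ∀ j, ∫⁻ y : Fin d → ℝ, ENNReal.ofReal ((|y j| / t) ^ s) ^ 2 *
      ‖fourierInt (toPi f) y‖ₑ ^ 2 ≤ ENNReal.ofReal ((t ^ s)⁻¹ ^ 2 * N ^ 2) := by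
    intro j
    rw [ENNReal.ofReal_mul (by positivity)]
    refine le_trans ?_ (mul_le_mul_right (lintegral_pow_mul_fourierInt_sq_le hf j) _)
    rw [← lintegral_const_mul' _ _ ENNReal.ofReal_ne_top]
    refine lintegral_mono fun y => ?_
    rw [← mul_assoc, div_pow, div_eq_inv_mul, ENNReal.ofReal_mul (by positivity), mul_pow,
      ENNReal.ofReal_pow (p := (t ^ s)⁻¹) (by positivity)]
  refine (mul_le_mul_right (Finset.sum_le_sum fun j _ => h2 j) _).trans (le_of_eq ?_)
  have h3 : ((n : ℝ) ^ (-(s : ℝ) / (d : ℝ) - 1 / 2)) ^ 2 = (n : ℝ)⁻¹ * (t ^ s)⁻¹ ^ 2 := by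
    have e1 : (t ^ s)⁻¹ = (n : ℝ) ^ (-(s : ℝ) / d) := by
      rw [ht_def, ← Real.rpow_natCast, ← Real.rpow_mul hn0.le, ← Real.rpow_neg hn0.le]
      congr 1; field_simp
    have e2 : ((n : ℝ) ^ (1 / 2 : ℝ)) ^ 2 = n := by
      rw [← Real.sqrt_eq_rpow, Real.sq_sqrt hn0.le]
    rw [e1, Real.rpow_sub hn0, div_pow, e2, div_eq_inv_mul]
  rw [Finset.sum_const, Finset.card_univ, Fintype.card_fin, nsmul_eq_mul, ← ENNReal.ofReal_natCast,
    ← ENNReal.ofReal_mul (by positivity), ← ENNReal.ofReal_mul (by positivity), h3, htd]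
  congr 1
  ring

end FrolovRandom

theorem mainTheorem7 (d s : ℕ) (hd : 1 ≤ d) (hs : (s : ℝ) > (d : ℝ) / 2)
    (B : Matrix (Fin d) (Fin d) ℝ) (hB : FrolovRandom.IsFrolovMatrix B) :
    ∃ c : ℝ, 0 < c ∧ ∀ n : ℕ, 1 ≤ n → ∀ f ∈ FrolovRandom.sobolevZero d s,
      ∀ (Ω : Type*) [MeasurableSpace Ω] (P : Measure Ω) [IsProbabilityMeasure P]
        (U V : Ω → Fin d → ℝ),
        pdf.IsUniform U (Set.Icc (fun _ => (1 : ℝ)) (fun _ => (2 : ℝ) ^ (1 / (d : ℝ)))) P →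
        pdf.IsUniform V (Set.Icc (fun _ => (0 : ℝ)) (fun _ => (1 : ℝ))) P →
        IndepFun U V P →
        Integrable (fun ω => |FrolovRandom.quadRule (FrolovRandom.dilatedMatrix n (U ω) B) (V ω) f
          - ∫ x, f x| ^ 2) P ∧
        Real.sqrt (∫ ω, |FrolovRandom.quadRule (FrolovRandom.dilatedMatrix n (U ω) B) (V ω) f
          - ∫ x, f x| ^ 2 ∂P) ≤
          c * (n : ℝ) ^ (-(s : ℝ) / (d : ℝ) - 1 / 2) *
            FrolovRandom.sobolevNorm (FrolovRandom.openUnitCube d) s f := by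
  have hd0 : (0 : ℝ) < d := by exact_mod_cast hd
  set b : ℝ := (2 : ℝ) ^ (1 / (d : ℝ)) with hb_def
  have hb : 1 < b := Real.one_lt_rpow (by norm_num) (by positivity)
  set κ : ℝ := (b - 1) ^ d with hκ_def
  have hκ : 0 < κ := pow_pos (sub_pos.2 hb) d
  -- Here `κ⁻¹` is the density of `U`, 3 comes from the weight bound, and `d` from summing over the
  -- coordinates.
  refine ⟨Real.sqrt (κ⁻¹ * (3 * d)), Real.sqrt_pos.2 (by positivity), ?_⟩
  intro n hn f hf Ω _ P _ U V hU hV hUV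
  set r : ℝ := (n : ℝ) ^ (-(s : ℝ) / (d : ℝ) - 1 / 2) with hr_def
  have hr : 0 ≤ r := Real.rpow_nonneg (Nat.cast_nonneg n) _
  set N := FrolovRandom.sobolevNorm (FrolovRandom.openUnitCube d) s f
  have hN : 0 ≤ N := Real.sqrt_nonneg _
  have hvolU : volume (Set.Icc (fun _ : Fin d => (1 : ℝ)) (fun _ => b)) = ENNReal.ofReal κ := by
    rw [Real.volume_Icc_pi, Finset.prod_const, Finset.card_univ, Fintype.card_fin,
      ENNReal.ofReal_pow (sub_pos.2 hb).le]
  have hvolV : volume (Set.Icc (fun _ : Fin d => (0 : ℝ)) (fun _ => (1 : ℝ))) = 1 := by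
    rw [Real.volume_Icc_pi]; simp
  have hUm : AEMeasurable U P := hU.aemeasurable
    (by rw [hvolU]; exact (ENNReal.ofReal_pos.2 hκ).ne') (by rw [hvolU]; exact ENNReal.ofReal_ne_top)
  have hVm : AEMeasurable V P := hV.aemeasurable
    (by rw [hvolV]; exact one_ne_zero) (by rw [hvolV]; exact ENNReal.one_ne_top)
  -- By independence the joint law is a product, so the expectation becomes the iterated integral
  -- already bounded; closed and half-open boxes differ by a null set.
  have hlaw : P.map (fun ω => (U ω, V ω)) =
      ((ENNReal.ofReal κ)⁻¹ • volume.restrict (Set.Icc (fun _ => (1 : ℝ)) (fun _ => b))).prod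
        (volume.restrict (FrolovRandom.halfOpenBox d)) := by
    rw [(indepFun_iff_map_prod_eq_prod_map_map hUm hVm).1 hUV, hU, hV,
      FrolovRandom.cond_Icc_zero_one, ProbabilityTheory.cond, hvolU]
  have hQ := (FrolovRandom.measurable_quadRule_dilatedMatrix (n := n) (B := B) hf.1).sub_const
    (∫ x, f x)
  have hbound : ∫⁻ ω, ‖FrolovRandom.quadRule (FrolovRandom.dilatedMatrix n (U ω) B) (V ω) f
      - ∫ x, f x‖ₑ ^ 2 ∂P ≤ ENNReal.ofReal (κ⁻¹ * (3 * d) * r ^ 2 * N ^ 2) := by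
    have h1 := lintegral_map' (μ := P) (f := fun p : (Fin d → ℝ) × (Fin d → ℝ) =>
      ‖FrolovRandom.quadRule (FrolovRandom.dilatedMatrix n p.1 B) p.2 f - ∫ x, f x‖ₑ ^ 2)
      (hQ.enorm.pow_const 2).aemeasurable (hUm.prodMk hVm)
    rw [← h1, hlaw, lintegral_prod _ (hQ.enorm.pow_const 2).aemeasurable, lintegral_smul_measure,
      ← ENNReal.ofReal_inv_of_pos hκ, mul_assoc, mul_assoc, ENNReal.ofReal_mul (by positivity),
      smul_eq_mul, ← mul_assoc (3 * (d : ℝ))]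
    exact mul_le_mul_right (FrolovRandom.lintegral_lintegral_quadRule_sub_sq_le hd hn hB hf) _
  have henorm : ∀ ω, ‖|FrolovRandom.quadRule (FrolovRandom.dilatedMatrix n (U ω) B) (V ω) f
      - ∫ x, f x| ^ 2‖ₑ = ‖FrolovRandom.quadRule (FrolovRandom.dilatedMatrix n (U ω) B) (V ω) f
        - ∫ x, f x‖ₑ ^ 2 := by
    intro ω
    rw [enorm_pow, ← ofReal_norm, ← ofReal_norm, Real.norm_eq_abs, Real.norm_eq_abs, abs_abs]
  have hint : Integrable (fun ω => |FrolovRandom.quadRule (FrolovRandom.dilatedMatrix n (U ω) B)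
      (V ω) f - ∫ x, f x| ^ 2) P := by
    refine ⟨((hQ.abs.pow_const 2).comp_aemeasurable (hUm.prodMk hVm)).aestronglyMeasurable, ?_⟩
    rw [HasFiniteIntegral, lintegral_congr henorm]
    exact hbound.trans_lt ENNReal.ofReal_lt_top
  refine ⟨hint, ?_⟩
  have hle : ∫ ω, |FrolovRandom.quadRule (FrolovRandom.dilatedMatrix n (U ω) B) (V ω) f
      - ∫ x, f x| ^ 2 ∂P ≤ κ⁻¹ * (3 * d) * r ^ 2 * N ^ 2 := by
    rw [← ENNReal.ofReal_le_ofReal_iff (by positivity), ofReal_integral_eq_lintegral_ofReal hint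
      (Filter.Eventually.of_forall fun _ => by positivity)]
    refine le_trans (le_of_eq (lintegral_congr fun ω => ?_)) hbound
    rw [← henorm, Real.enorm_of_nonneg (by positivity)]
  refine (Real.sqrt_le_sqrt hle).trans (le_of_eq ?_)
  rw [Real.sqrt_mul' _ (sq_nonneg N), Real.sqrt_mul' _ (sq_nonneg r), Real.sqrt_sq hN,
    Real.sqrt_sq hr]
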